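/- Fix $\tau,\eta\in\mathbb C$ with $\operatorname{Im}\tau>0$ and let $$\theta(t)=-\sum_{j\in\mathbb Z}e^{\pi i(j+\frac12)^2\tau+2\pi i(j+\frac12)(t+\frac12)},\quad \alpha(z,\lambda)=\frac{\theta(\lambda+2\eta)\theta(z)}{\theta(\lambda)\theta(z-2\eta)},\quad \beta(z,\lambda)=-\frac{\theta(\lambda+z)\theta(2\eta)}{\theta(\lambda)\theta(z-2\eta)}.$$ Let $V$ have basis $e[1],e[-1]$, $E_{ij}e[k]=\delta_{jk}e[i]$, $h=E_{11}-E_{-1,-1}$, and let $R(z,\lambda)\in\operatorname{End}(V\otimes V)$ be $$R(z,\lambda)=E_{11}\otimes E_{11}+E_{-1,-1}\otimes E_{-1,-1}+\alpha(z,\lambda)E_{11}\otimes E_{-1,-1}+\alpha(z,-\lambda)E_{-1,-1}\otimes E_{11}+\beta(z,\lambda)E_{1,-1}\otimes E_{-1,1}+\beta(z,-\lambda)E_{-1,1}\otimes E_{1,-1}.$$ A module over $E_{\tau,\eta}(sl_2)$ is a complex vector space $W=\bigoplus_{\mu\in\mathbb C}W[\mu]$, the direct sum of finite-dimensional eigenspaces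 $W[\mu]$ of an operator $h$, with an operator $L(z,\lambda)\in\operatorname{End}(V\otimes W)$ commuting with $h^{(1)}+h^{(2)}$, meromorphic in $(z,\lambda)\in\mathbb C^2$, such that $$R^{(12)}(z-w,\lambda-2\eta h^{(3)})L^{(13)}(z,\lambda)L^{(23)}(w,\lambda-2\eta h^{(1)})=L^{(23)}(w,\lambda)L^{(13)}(z,\lambda-2\eta h^{(2)})R^{(12)}(z-w,\lambda)$$ in $\operatorname{End}(V\otimes V\otimes W)$. Let $\operatorname{Fun}(W)$ be the space of $W$-valued meromorphic functions of $\lambda$ and $\operatorname{Fun}(W)[\mu]$ the subspace of those with values in $W[\mu]$. Call $z$ regular if $L$ has no pole along $\{z\}\times\mathbb C$; for such $z$ put $(\tilde L(z)(e[\mu]\otimes f))(\lambda)=L(z,\lambda)(e[\mu]\otimes f(\lambda-2\eta\mu))$ for $\mu=\pm1$ and define operators $a(z),b(z),c(z),d(z)$ on $\operatorname{Fun}(W)$ by $$\tilde L(z)(e[1]\otimes f)=e[1]\otimes a(z)f+e[-1]\otimes c(z)f,\qquad \tilde L(z)(e[-1]\otimes f)=e[1]\otimes b(z)f+e[-1]\otimes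 d(z)f.$$ Let $T(z)=a(z)+d(z)$. The module $W$ is a highest weight module of highest weight $(\Lambda,A,D)$ if there is a non-zero $v_0\in\operatorname{Fun}(W)[\Lambda]$ with $c(z)v_0=0$, $a(z)v_0=A(z,\lambda)v_0$, $d(z)v_0=D(z,\lambda)v_0$, and $\operatorname{Fun}(W)$ is spanned over the field of meromorphic functions of $\lambda$ by the vectors $b(s_1)\cdots b(s_r)v_0$, $r\ge0$. **Theorem.** Let $z_1,\dots,z_n,\Lambda_1,\dots,\Lambda_n\in\mathbb C$, $p_j=z_j+\eta(-\Lambda_j+1)$, $q_j=z_j+\eta(\Lambda_j+1)$, and suppose $\Lambda=\sum_j\Lambda_j=2m$ with $m\in\mathbb Z_{\ge0}$. Let $W$ be a highest weight module of highest weight $(\Lambda,A,D)$ with $$A(z,\lambda)=1,\qquad D(z,\lambda)=\frac{\theta(\lambda-2\eta\Lambda)}{\theta(\lambda)}\prod_{j=1}^n\frac{\theta(z-p_j)}{\theta(z-q_j)},$$ and highest weight vector $v_0$. Let $c\in\mathbb C$ and $v(\lambda)=e^{c\lambda}\prod_{j=1}^m\theta(\lambda-2\eta j)\,v_0(\lambda)$.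 Let $t_1,\dots,t_m$ be regular points, pairwise distinct modulo $\mathbb Z+\tau\mathbb Z$, that solve the Bethe ansatz equations (all denominators being non-zero) $$\prod_{j\ne i}\frac{\theta(t_j-t_i-2\eta)}{\theta(t_j-t_i+2\eta)}\prod_{k=1}^n\frac{\theta(t_i-q_k)}{\theta(t_i-p_k)}=e^{4\eta c},\qquad i=1,\dots,m.$$ Then $\psi=b(t_1)\cdots b(t_m)v$ lies in $H=\operatorname{Fun}(W)[0]$, and $T(w)\psi=\epsilon(w)\psi$ for every regular $w$, where $$\epsilon(w)=e^{-2\eta c}\prod_{j=1}^m\frac{\theta(t_j-w-2\eta)}{\theta(t_j-w)}+e^{2\eta c}\prod_{j=1}^m\frac{\theta(t_j-w+2\eta)}{\theta(t_j-w)}\prod_{k=1}^n\frac{\theta(w-p_k)}{\theta(w-q_k)};$$ at regular points $w$ where a denominator of this formula vanishes, $\epsilon$ has a removable singularity and $\epsilon(w)$ denotes the limit. (So $\psi$ is a common eigenvector of all transfer matrices whenever it is not zero.) -/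

import Mathlib

open Filter Topology
open scoped Kronecker

noncomputable section

namespace EllipticBethe

/-! ### Theta function and the dynamical R-matrix -/

/-- Jacobi's (odd) theta function
`θ(t) = -∑_{j ∈ ℤ} exp(πi (j+1/2)² τ + 2πi (j+1/2)(t+1/2))`. -/
def theta (τ t : ℂ) : ℂ :=
  -∑' j : ℤ, Complex.exp (Real.pi * Complex.I * ((j : ℂ) + 1 / 2) ^ 2 * τ
    + 2 * Real.pi * Complex.I * ((j : ℂ) + 1 / 2) * (t + 1 / 2))

/-- `α(z,λ) = θ(λ+2η)θ(z) / (θ(λ)θ(z-2η))`. -/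
def alpha (τ η z l : ℂ) : ℂ :=
  theta τ (l + 2 * η) * theta τ z / (theta τ l * theta τ (z - 2 * η))

/-- `β(z,λ) = -θ(λ+z)θ(2η) / (θ(λ)θ(z-2η))`. -/
def beta (τ η z l : ℂ) : ℂ :=
  -(theta τ (l + z) * theta τ (2 * η)) / (theta τ l * theta τ (z - 2 * η))

/-- The basis vectors `e[1]`, `e[-1]` of `V` are indexed by `0, 1 : Fin 2`;
`wt` is the corresponding eigenvalue of `h`. -/
def wt (i : Fin 2) : ℂ := if i = 0 then 1 else -1

/-- The matrix unit `E_{ij}`, `E_{ij} e_k = δ_{jk} e_i`. -/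
def E (i j : Fin 2) : Matrix (Fin 2) (Fin 2) ℂ := Matrix.single i j 1

/-- The R-matrix `R(z,λ) ∈ End(V ⊗ V)`; the entry `R (k,l) (i,j)` is the coefficient of
`e_k ⊗ e_l` in `R(z,λ)(e_i ⊗ e_j)`. -/
def R (τ η z l : ℂ) : Matrix (Fin 2 × Fin 2) (Fin 2 × Fin 2) ℂ :=
  E 0 0 ⊗ₖ E 0 0 + E 1 1 ⊗ₖ E 1 1
    + alpha τ η z l • (E 0 0 ⊗ₖ E 1 1) + alpha τ η z (-l) • (E 1 1 ⊗ₖ E 0 0)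
    + beta τ η z l • (E 0 1 ⊗ₖ E 1 0) + beta τ η z (-l) • (E 1 0 ⊗ₖ E 0 1)

/-! ### Meromorphic functions

A meromorphic function is represented by an everywhere defined function whose values on the polar
set carry no information; two functions of one variable represent the same meromorphic function
iff they agree on a codiscrete set, and identities between meromorphic functions of several
variables are required on a set with dense interior. -/

/-- Meromorphic functions of two complex variables: locally quotients of holomorphic functions
(with denominator not identically zero), off the zero set of the denominator. -/
def Meromorphic₂ (f : ℂ × ℂ → ℂ) : Prop :=
  ∀ x, ∃ g h : ℂ × ℂ → ℂ, AnalyticAt ℂ g x ∧ AnalyticAt ℂ h x ∧ (¬ ∀ᶠ y in 𝓝 x, h y = 0) ∧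
    ∀ᶠ y in 𝓝 x, h y ≠ 0 → f y = g y / h y

section Vector

variable {W : Type*} [AddCommGroup W] [Module ℂ W]

/-- `F ∈ Fun(W)`: meromorphic functions of one variable with values in `W`. -/
def MeroFun (F : ℂ → W) : Prop :=
  ∃ (k : ℕ) (f : Fin k → ℂ → ℂ) (u : Fin k → W),
    (∀ i, Meromorphic (f i)) ∧ ∀ x, F x = ∑ i, f i x • u i

/-- Meromorphic functions of two variables with values in `W`. -/
def MeroFun₂ (F : ℂ × ℂ → W) : Prop :=
  ∃ (k : ℕ) (f : Fin k → ℂ × ℂ → ℂ) (u : Fin k → W),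
    (∀ i, Meromorphic₂ (f i)) ∧ ∀ x, F x = ∑ i, f i x • u i

/-- A `W`-valued function of two variables is holomorphic near `x`. -/
def HolAt (F : ℂ × ℂ → W) (x : ℂ × ℂ) : Prop :=
  ∃ (k : ℕ) (f : Fin k → ℂ × ℂ → ℂ) (u : Fin k → W),
    (∀ i, AnalyticAt ℂ (f i) x) ∧ ∀ᶠ y in 𝓝 x, F y = ∑ i, f i y • u i

end Vector

/-! ### Modules over the elliptic quantum group -/

/-- A module over `E_{τ,η}(sl₂)`: a diagonalizable `h`-module `W` with finite dimensional weight
spaces and a meromorphic `L`-operator. The operator `L(z,λ) ∈ End(V ⊗ W)` is given by its matrix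
over `End W`: `L(z,λ)(e_j ⊗ u) = ∑_i e_i ⊗ L z λ i j u`. -/
structure EModule (τ η : ℂ) (W : Type*) [AddCommGroup W] [Module ℂ W] where
  h : Module.End ℂ W
  finite_weight : ∀ μ : ℂ, FiniteDimensional ℂ (h.eigenspace μ)
  diagonalizable : ⨆ μ : ℂ, h.eigenspace μ = ⊤
  L : ℂ → ℂ → Fin 2 → Fin 2 → Module.End ℂ W
  /-- `L(z,λ)` commutes with `h⁽¹⁾ + h⁽²⁾`. -/
  L_weight : ∀ z l i j μ, ∀ u ∈ h.eigenspace μ, L z l i j u ∈ h.eigenspace (μ + wt j - wt i)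
  L_mero : ∀ i j u, MeroFun₂ fun x : ℂ × ℂ => L x.1 x.2 i j u
  /-- The relation
  `R⁽¹²⁾(z-w,λ-2ηh⁽³⁾) L⁽¹³⁾(z,λ) L⁽²³⁾(w,λ-2ηh⁽¹⁾)
    = L⁽²³⁾(w,λ) L⁽¹³⁾(z,λ-2ηh⁽²⁾) R⁽¹²⁾(z-w,λ)`
  in `End(V ⊗ V ⊗ W)`: both sides are applied to `e_i ⊗ e_j ⊗ u` with `u` of weight `μ`, and the
  coefficients of `e_{i'} ⊗ e_{j'}` are compared. The vector `L⁽¹³⁾ L⁽²³⁾ u` standing next to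
  `e_k ⊗ e_l` has weight `μ + wt i + wt j - wt k - wt l`. -/
  RLL : ∀ (i j i' j' : Fin 2) (μ : ℂ), ∀ u ∈ h.eigenspace μ,
    Dense (interior {x : ℂ × ℂ × ℂ | ∀ z w lam : ℂ, x = (z, w, lam) →
      ∑ k, ∑ l, R τ η (z - w) (lam - 2 * η * (μ + wt i + wt j - wt k - wt l)) (i', j') (k, l) •
          L z lam k i (L w (lam - 2 * η * wt i) l j u)
        = ∑ k, ∑ l, R τ η (z - w) lam (k, l) (i, j) •
          L w lam j' l (L z (lam - 2 * η * wt l) i' k u)})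

namespace EModule

variable {τ η : ℂ} {W : Type*} [AddCommGroup W] [Module ℂ W] (M : EModule τ η W)

/-- `z` is a regular value of the spectral parameter: `L` has no pole along `{z} × ℂ`, so that the
operators `a(z), b(z), c(z), d(z)` on `Fun(W)` are defined. On each vector, `L(z,·)` is then a
meromorphic function, and `L` is holomorphic at `(z,λ)` for all `λ` outside a discrete set. -/
def IsRegular (z : ℂ) : Prop :=
  ∀ i j u, MeroFun (fun l => M.L z l i j u) ∧
    ∀ᶠ l in codiscrete ℂ, HolAt (fun x : ℂ × ℂ => M.L x.1 x.2 i j u) (z, l)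

/-- The matrix entries of `L̃(z)`, where
`(L̃(z)(e_j ⊗ f))(λ) = L(z,λ)(e_j ⊗ f(λ - 2η wt j))`. -/
def entry (i j : Fin 2) (z : ℂ) (f : ℂ → W) : ℂ → W :=
  fun l => M.L z l i j (f (l - 2 * η * wt j))

def a (z : ℂ) (f : ℂ → W) : ℂ → W := M.entry 0 0 z f

def b (z : ℂ) (f : ℂ → W) : ℂ → W := M.entry 0 1 z f

def c (z : ℂ) (f : ℂ → W) : ℂ → W := M.entry 1 0 z f

def d (z : ℂ) (f : ℂ → W) : ℂ → W := M.entry 1 1 z f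

/-- The transfer matrix `T(z) = a(z) + d(z)`. -/
def T (z : ℂ) (f : ℂ → W) : ℂ → W := M.a z f + M.d z f

/-- `b(t₁) ⋯ b(t_m) f` for a list `[t₁, …, t_m]`. -/
def bProd (t : List ℂ) (f : ℂ → W) : ℂ → W := t.foldr M.b f

/-- `f ∈ Fun(W)[μ]`: meromorphic functions with values in the weight space `W[μ]`. -/
def MemFunWeight (μ : ℂ) (f : ℂ → W) : Prop :=
  MeroFun f ∧ ∀ᶠ l in codiscrete ℂ, f l ∈ M.h.eigenspace μ

/-- `W` is a highest weight module of highest weight `(Λ, A, D)` with highest weight vector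
`v₀ ∈ Fun(W)`. -/
structure IsHighestWeight (Λ : ℂ) (A D : ℂ → ℂ → ℂ) (v₀ : ℂ → W) : Prop where
  mem : M.MemFunWeight Λ v₀
  ne_zero : ¬ v₀ =ᶠ[codiscrete ℂ] 0
  c_eq : Dense (interior {x : ℂ × ℂ | M.c x.1 v₀ x.2 = 0})
  a_eq : Dense (interior {x : ℂ × ℂ | M.a x.1 v₀ x.2 = A x.1 x.2 • v₀ x.2})
  d_eq : Dense (interior {x : ℂ × ℂ | M.d x.1 v₀ x.2 = D x.1 x.2 • v₀ x.2})
  /-- `Fun(W)` is spanned by the `b(s₁) ⋯ b(s_r) v₀` over the field of meromorphic functions. -/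
  span : ∀ f : ℂ → W, MeroFun f → ∃ (k : ℕ) (g : Fin k → ℂ → ℂ) (s : Fin k → List ℂ),
    (∀ i, Meromorphic (g i)) ∧ (∀ i, ∀ x ∈ s i, M.IsRegular x) ∧
      f =ᶠ[codiscrete ℂ] fun l => ∑ i, g i l • M.bProd (s i) v₀ l

end EModule

/-! ### Bethe ansatz data -/

section Bethe

variable {n m : ℕ}

/-- `p_j = z_j + η(-Λ_j + 1)`. -/
def pPt (η : ℂ) (z Λs : Fin n → ℂ) (j : Fin n) : ℂ := z j + η * (-Λs j + 1)

/-- `q_j = z_j + η(Λ_j + 1)`. -/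
def qPt (η : ℂ) (z Λs : Fin n → ℂ) (j : Fin n) : ℂ := z j + η * (Λs j + 1)

/-- `D(w,λ) = θ(λ-2ηΛ)/θ(λ) ∏_j θ(w-p_j)/θ(w-q_j)`. -/
def Dfun (τ η Λ : ℂ) (p q : Fin n → ℂ) (w l : ℂ) : ℂ :=
  theta τ (l - 2 * η * Λ) / theta τ l * ∏ j, theta τ (w - p j) / theta τ (w - q j)

/-- `v(λ) = e^{cλ} ∏_{j=1}^m θ(λ-2ηj) v₀(λ)`. -/
def vFun {W : Type*} [AddCommGroup W] [Module ℂ W] (τ η c : ℂ) (m : ℕ) (v₀ : ℂ → W) : ℂ → W :=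
  fun l => (Complex.exp (c * l) * ∏ j ∈ Finset.Icc 1 m, theta τ (l - 2 * η * (j : ℂ))) • v₀ l

/-- The Bethe ansatz equations. All denominators are required to be non-zero. -/
def BetheEqs (τ η c : ℂ) (p q : Fin n → ℂ) (t : Fin m → ℂ) : Prop :=
  (∀ i j, j ≠ i → theta τ (t j - t i + 2 * η) ≠ 0) ∧ (∀ i k, theta τ (t i - p k) ≠ 0) ∧
  ∀ i, (∏ j ∈ Finset.univ.erase i, theta τ (t j - t i - 2 * η) / theta τ (t j - t i + 2 * η)) *
      ∏ k, theta τ (t i - q k) / theta τ (t i - p k) = Complex.exp (4 * η * c)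

/-- The eigenvalue `ε(w)`. -/
def eigval (τ η c : ℂ) (p q : Fin n → ℂ) (t : Fin m → ℂ) (w : ℂ) : ℂ :=
  Complex.exp (-2 * η * c) * ∏ j, theta τ (t j - w - 2 * η) / theta τ (t j - w)
    + Complex.exp (2 * η * c) * (∏ j, theta τ (t j - w + 2 * η) / theta τ (t j - w)) *
      ∏ k, theta τ (w - p k) / theta τ (w - q k)

end Bethe

end EllipticBethe

end

/-!
The operators `a(s)` and `d(s)` are moved through `b(t₁) ⋯ b(t_m)` by the exchange relations, which
are entries of the RLL relation. Besides the wanted term, in which the `b(t_j)` are unchanged, this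
produces unwanted terms in which one `b(t_i)` has become `b(s)`. The three-term identity of the
theta function collects the contributions to each unwanted term into a single product. The factor
`∏ θ(λ - 2ηj)` in `v` makes the dependence of these coefficients on `λ` trivial for `a` and `d`
alike, and the Bethe ansatz equations say that the unwanted terms of `a(s)` and `d(s)` cancel.

This argument works at generic spectral parameters, where all the denominators are non-zero; since
both sides are continuous at almost every `λ` over a regular point, the result extends to regular
points by density. The eigenvalue has a limit at `t_i`, because the Bethe ansatz equations also
express the vanishing of its residue there, and at the translates of `t_i` by the lattice, because
it is quasi-periodic. At the other regular points it has a limit because `d(w) v₀` does and `v₀` is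
not zero.
-/

noncomputable section

namespace EllipticBethe

open Complex
open scoped Real

section Theta

/-- The general term of the series for `-theta`. -/
def thetaTerm (τ t : ℂ) (j : ℤ) : ℂ :=
  exp (π * I * ((j : ℂ) + 1 / 2) ^ 2 * τ + 2 * π * I * ((j : ℂ) + 1 / 2) * (t + 1 / 2))

/-- The even member of a basis of the theta functions of degree two; the odd one is
`x ↦ theta (2 * τ) (2 * x - 1 / 2)`, here called `thetaOdd`. -/
def thetaEven (τ x : ℂ) : ℂ := jacobiTheta₂ (2 * x) (2 * τ)

/-- The odd partner of `thetaEven`. -/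
def thetaOdd (τ x : ℂ) : ℂ := theta (2 * τ) (2 * x - 1 / 2)

lemma thetaTerm_eq (τ t : ℂ) (j : ℤ) :
    thetaTerm τ t j =
      exp (π * I * (τ / 4 + t + 1 / 2)) * jacobiTheta₂_term j (t + 1 / 2 + τ / 2) τ := by
  rw [thetaTerm, jacobiTheta₂_term, ← Complex.exp_add]
  congr 1; ring

lemma theta_eq (τ t : ℂ) :
    theta τ t = -(exp (π * I * (τ / 4 + t + 1 / 2)) * jacobiTheta₂ (t + 1 / 2 + τ / 2) τ) := by
  rw [jacobiTheta₂, ← tsum_mul_left]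
  simp only [← thetaTerm_eq]
  rfl

lemma exp_eq_of_sub_int {x y : ℂ} (n : ℤ) (h : x = y + n * (2 * π * I)) : exp x = exp y :=
  exp_eq_exp_iff_exists_int.2 ⟨n, h⟩

lemma exp_eq_neg_of_sub_int {x y : ℂ} (n : ℤ) (h : x = y + π * I + n * (2 * π * I)) :
    exp x = -exp y := by
  rw [exp_eq_of_sub_int n h, Complex.exp_add, exp_pi_mul_I, mul_neg_one]

variable {τ : ℂ}

lemma hasSum_thetaTerm (hτ : 0 < τ.im) (t : ℂ) : HasSum (thetaTerm τ t) (-theta τ t) := by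
  rw [theta_eq, neg_neg, funext (thetaTerm_eq τ t)]
  exact (hasSum_jacobiTheta₂_term _ hτ).mul_left _

lemma im_two_mul_pos (hτ : 0 < τ.im) : 0 < (2 * τ).im := by
  simpa using hτ

/-- The bijection underlying the product formula `theta_mul_theta`: a pair of integers is
`(a + b, a - b - 1)` or `(a + b, a - b)`, according to the parity of its sum. -/
def parityMap : (ℤ × ℤ) ⊕ (ℤ × ℤ) → ℤ × ℤ :=
  Sum.elim (fun p => (p.1 + p.2, p.1 - p.2 - 1)) (fun p => (p.1 + p.2, p.1 - p.2))

lemma parityMap_bijective : Function.Bijective parityMap := by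
  constructor
  · rintro (⟨a, b⟩ | ⟨a, b⟩) (⟨c, d⟩ | ⟨c, d⟩) h <;>
      simp only [parityMap, Sum.elim_inl, Sum.elim_inr, Prod.mk.injEq] at h
    · simp only [Sum.inl.injEq, Prod.mk.injEq]; omega
    · omega
    · omega
    · simp only [Sum.inr.injEq, Prod.mk.injEq]; omega
  · rintro ⟨j, k⟩
    rcases Int.even_or_odd' (j + k) with ⟨a, ha | ha⟩
    · exact ⟨Sum.inr (a, j - a), by simp only [parityMap, Sum.elim_inr, Prod.mk.injEq]; omega⟩
    · exact ⟨Sum.inl (a + 1, j - a - 1), by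
        simp only [parityMap, Sum.elim_inl, Prod.mk.injEq]; omega⟩

lemma thetaTerm_mul_thetaTerm_of_odd (x y : ℂ) (a b : ℤ) :
    thetaTerm τ (x + y) (a + b) * thetaTerm τ (x - y) (a - b - 1) =
      jacobiTheta₂_term a (2 * x) (2 * τ) * thetaTerm (2 * τ) (2 * y - 1 / 2) b := by
  simp only [thetaTerm, jacobiTheta₂_term, ← Complex.exp_add]
  refine exp_eq_of_sub_int a ?_
  push_cast; ring

lemma thetaTerm_mul_thetaTerm_of_even (x y : ℂ) (a b : ℤ) :
    thetaTerm τ (x + y) (a + b) * thetaTerm τ (x - y) (a - b) =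
      -(thetaTerm (2 * τ) (2 * x - 1 / 2) a * jacobiTheta₂_term b (2 * y) (2 * τ)) := by
  simp only [thetaTerm, jacobiTheta₂_term, ← Complex.exp_add]
  refine exp_eq_neg_of_sub_int a ?_
  push_cast; ring

lemma hasSum_mul {f g : ℤ → ℂ} {a b : ℂ} (hf : HasSum f a) (hg : HasSum g b) :
    HasSum (fun p : ℤ × ℤ => f p.1 * g p.2) (a * b) :=
  hf.mul hg (summable_mul_of_summable_norm hf.summable.norm hg.summable.norm)

theorem theta_mul_theta (hτ : 0 < τ.im) (x y : ℂ) :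
    theta τ (x + y) * theta τ (x - y) =
      thetaOdd τ x * thetaEven τ y - thetaEven τ x * thetaOdd τ y := by
  have hE (x) : HasSum (fun a => jacobiTheta₂_term a (2 * x) (2 * τ)) (thetaEven τ x) :=
    hasSum_jacobiTheta₂_term _ (im_two_mul_pos hτ)
  have hO (x) : HasSum (thetaTerm (2 * τ) (2 * x - 1 / 2)) (-thetaOdd τ x) :=
    hasSum_thetaTerm (im_two_mul_pos hτ) _
  have hodd := hasSum_mul (hE x) (hO y)
  have heven := (hasSum_mul (hO x) (hE y)).neg
  simp only [← thetaTerm_mul_thetaTerm_of_odd] at hodd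
  simp only [← thetaTerm_mul_thetaTerm_of_even] at heven
  have hprod := hasSum_mul (hasSum_thetaTerm hτ (x + y)) (hasSum_thetaTerm hτ (x - y))
  rw [← (Equiv.ofBijective _ parityMap_bijective).hasSum_iff] at hprod
  linear_combination hprod.unique (HasSum.sum hodd heven)

lemma differentiable_jacobiTheta₂ (hτ : 0 < τ.im) : Differentiable ℂ fun z => jacobiTheta₂ z τ :=
  fun z => differentiableAt_jacobiTheta₂_fst z hτ

@[fun_prop]
lemma differentiable_theta (hτ : 0 < τ.im) : Differentiable ℂ (theta τ) := by
  have hJ : Differentiable ℂ fun t => jacobiTheta₂ (t + 1 / 2 + τ / 2) τ :=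
    (differentiable_jacobiTheta₂ hτ).comp (by fun_prop)
  rw [funext (theta_eq τ)]
  fun_prop

lemma differentiable_thetaEven (hτ : 0 < τ.im) : Differentiable ℂ (thetaEven τ) :=
  (differentiable_jacobiTheta₂ (im_two_mul_pos hτ)).comp (by fun_prop)

lemma differentiable_thetaOdd (hτ : 0 < τ.im) : Differentiable ℂ (thetaOdd τ) :=
  (differentiable_theta (im_two_mul_pos hτ)).comp (by fun_prop)

lemma continuous_theta (hτ : 0 < τ.im) : Continuous (theta τ) :=
  (differentiable_theta hτ).continuous

lemma theta_add_one (t : ℂ) : theta τ (t + 1) = -theta τ t := by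
  rw [theta_eq, theta_eq, show t + 1 + 1 / 2 + τ / 2 = t + 1 / 2 + τ / 2 + 1 by ring,
    jacobiTheta₂_add_left, exp_eq_neg_of_sub_int (y := π * I * (τ / 4 + t + 1 / 2)) 0]
  · ring
  · push_cast; ring

lemma theta_add_tau (t : ℂ) :
    theta τ (t + τ) = -exp (-(π * I * (τ + 2 * t))) * theta τ t := by
  rw [theta_eq, theta_eq, show t + τ + 1 / 2 + τ / 2 = t + 1 / 2 + τ / 2 + τ by ring,
    jacobiTheta₂_add_left', ← mul_assoc, ← Complex.exp_add, neg_mul_neg, ← mul_assoc,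
    ← Complex.exp_add, ← neg_mul]
  congr 1
  rw [neg_eq_iff_eq_neg]
  refine exp_eq_neg_of_sub_int (-1) ?_
  push_cast; ring

lemma theta_neg (t : ℂ) : theta τ (-t) = -theta τ t := by
  have h : jacobiTheta₂ (-t + 1 / 2 + τ / 2) τ =
      -(exp (2 * π * I * t) * jacobiTheta₂ (t + 1 / 2 + τ / 2) τ) := by
    rw [← jacobiTheta₂_neg_left,
      show t + 1 / 2 + τ / 2 = -(-t + 1 / 2 + τ / 2) + 1 + τ by ring, jacobiTheta₂_add_left',
      jacobiTheta₂_add_left, ← mul_assoc, ← Complex.exp_add,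
      exp_eq_neg_of_sub_int (y := 0) (-1), Complex.exp_zero]
    · ring
    · push_cast; ring
  rw [theta_eq, theta_eq, h, mul_neg, ← mul_assoc, ← Complex.exp_add]
  congr 4; ring

lemma theta_zero : theta τ 0 = 0 := by
  have h := theta_neg (τ := τ) 0
  rw [neg_zero] at h
  linear_combination h / 2

lemma theta_mul_theta_of_eq (hτ : 0 < τ.im) {s t x y : ℂ} (hs : x + y = s) (ht : x - y = t) :
    theta τ s * theta τ t = thetaOdd τ x * thetaEven τ y - thetaEven τ x * thetaOdd τ y := by
  rw [← hs, ← ht, theta_mul_theta hτ]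

theorem theta_three_term (hτ : 0 < τ.im) (l e x y : ℂ) :
    theta τ l * theta τ (x - e) * theta τ (l + e + y) * theta τ (x - y)
      - theta τ (l + x) * theta τ e * theta τ (l + e + y - x) * theta τ y
      = theta τ (l + e) * theta τ (l + y) * theta τ (x - y - e) * theta τ x := by
  -- All six products are of the form `θ(A + B)θ(A - B)` with `A`, `B` among these four numbers.
  set A := l + (e + y) / 2
  set B := (e + y) / 2
  set C := x - (e + y) / 2
  set D := (y - e) / 2
  have hAB : theta τ (l + e + y) * theta τ l = _ :=
    theta_mul_theta_of_eq hτ (x := A) (y := B) (by ring) (by ring)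
  have hCD : theta τ (x - e) * theta τ (x - y) = _ :=
    theta_mul_theta_of_eq hτ (x := C) (y := D) (by ring) (by ring)
  have hAC : theta τ (l + x) * theta τ (l + e + y - x) = _ :=
    theta_mul_theta_of_eq hτ (x := A) (y := C) (by ring) (by ring)
  have hBD : theta τ y * theta τ e = _ :=
    theta_mul_theta_of_eq hτ (x := B) (y := D) (by ring) (by ring)
  have hAD : theta τ (l + y) * theta τ (l + e) = _ :=
    theta_mul_theta_of_eq hτ (x := A) (y := D) (by ring) (by ring)
  have hBC : theta τ x * theta τ (-(x - y - e)) = _ :=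
    theta_mul_theta_of_eq hτ (x := B) (y := C) (by ring) (by ring)
  rw [theta_neg] at hBC
  linear_combination theta τ (x - e) * theta τ (x - y) * hAB
    + (thetaOdd τ A * thetaEven τ B - thetaEven τ A * thetaOdd τ B) * hCD
    - theta τ y * theta τ e * hAC
    - (thetaOdd τ A * thetaEven τ C - thetaEven τ A * thetaOdd τ C) * hBD
    + theta τ x * -theta τ (x - y - e) * hAD
    + (thetaOdd τ A * thetaEven τ D - thetaEven τ A * thetaOdd τ D) * hBC

lemma integral_jacobiTheta₂_term_of_ne_zero (z : ℂ) {n : ℤ} (hn : n ≠ 0) :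
    ∫ x in (0 : ℝ)..1, jacobiTheta₂_term n (z + x) τ = 0 := by
  have hc : 2 * π * I * n ≠ 0 := mul_ne_zero two_pi_I_ne_zero (by exact_mod_cast hn)
  have hterm (x : ℝ) : jacobiTheta₂_term n (z + x) τ =
      jacobiTheta₂_term n z τ * exp (2 * π * I * n * x) := by
    simp only [jacobiTheta₂_term, ← Complex.exp_add]
    congr 1; ring
  have hperiod : exp (2 * π * I * n * (1 : ℝ)) = exp (2 * π * I * n * (0 : ℝ)) :=
    exp_eq_of_sub_int n (by push_cast; ring)
  simp only [hterm]
  rw [intervalIntegral.integral_const_mul, integral_exp_mul_complex hc, hperiod, sub_self,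
    zero_div, mul_zero]

lemma integral_jacobiTheta₂ (hτ : 0 < τ.im) (z : ℂ) :
    ∫ x in (0 : ℝ)..1, jacobiTheta₂ (z + x) τ = 1 := by
  have hcont (n : ℤ) : Continuous fun x : ℝ => jacobiTheta₂_term n (z + x) τ := by
    unfold jacobiTheta₂_term; fun_prop
  have hsum := intervalIntegral.hasSum_intervalIntegral_of_summable_norm (a := 0) (b := 1)
    (f := fun n : ℤ => (⟨fun x : ℝ => jacobiTheta₂_term n (z + x) τ, hcont n⟩ : C(ℝ, ℂ))) ?_
  · have hsingle := hasSum_single (f := fun n : ℤ =>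
      ∫ x in (0 : ℝ)..1, jacobiTheta₂_term n (z + x) τ) 0
      fun n hn => integral_jacobiTheta₂_term_of_ne_zero z hn
    exact hsum.unique (by simpa [jacobiTheta₂_term] using hsingle)
  · refine (summable_pow_mul_jacobiTheta₂_term_bound |z.im| hτ 0).of_nonneg_of_le
      (fun n => norm_nonneg _) fun n => (ContinuousMap.norm_le _ (by positivity)).2 fun x => ?_
    simpa using norm_jacobiTheta₂_term_le (z := z + (x : ℝ)) (S := |z.im|) hτ (by simp) le_rfl n

lemma exists_theta_ne_zero (hτ : 0 < τ.im) : ∃ t, theta τ t ≠ 0 := by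
  by_contra! h
  have hJ (z : ℂ) : jacobiTheta₂ z τ = 0 := by
    have := h (z - 1 / 2 - τ / 2)
    rw [theta_eq, show z - 1 / 2 - τ / 2 + 1 / 2 + τ / 2 = z by ring] at this
    simpa using this
  simpa [hJ] using integral_jacobiTheta₂ hτ 0

lemma eventually_theta_ne_zero (hτ : 0 < τ.im) : ∀ᶠ t in codiscrete ℂ, theta τ t ≠ 0 := by
  obtain ⟨t, ht⟩ := exists_theta_ne_zero hτ
  exact AnalyticOnNhd.preimage_zero_mem_codiscrete
    (fun x _ => (differentiable_theta hτ).analyticAt x) ht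

lemma nhdsNE_le_codiscrete {X : Type*} [TopologicalSpace X] (x : X) : 𝓝[≠] x ≤ codiscrete X :=
  fun s hs => by
    simp only [mem_codiscrete, disjoint_principal_right, compl_compl] at hs
    exact hs x

instance neBot_codiscrete : (codiscrete ℂ).NeBot :=
  NeBot.mono (inferInstance : (𝓝[≠] (0 : ℂ)).NeBot) (nhdsNE_le_codiscrete 0)

lemma tendsto_codiscrete_of_injective {X Y : Type*} [TopologicalSpace X] [TopologicalSpace Y]
    {f : X → Y} (hf : Continuous f) (hinj : Function.Injective f) :
    Tendsto f (codiscrete X) (codiscrete Y) := by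
  intro s hs
  simp only [mem_codiscrete, mem_map, disjoint_principal_right, compl_compl]
  intro x
  exact (hf.continuousWithinAt (s := {x}ᶜ) (x := x)).tendsto_nhdsWithin
    (t := {f x}ᶜ) (fun _ => hinj.ne) (nhdsNE_le_codiscrete _ hs)

lemma tendsto_add_const_codiscrete (a : ℂ) :
    Tendsto (fun x => x + a) (codiscrete ℂ) (codiscrete ℂ) :=
  tendsto_codiscrete_of_injective (by fun_prop) (add_left_injective a)

lemma eventually_codiscrete_sub_const {p : ℂ → Prop} (h : ∀ᶠ l in codiscrete ℂ, p l) (a : ℂ) :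
    ∀ᶠ l in codiscrete ℂ, p (l - a) := by
  simpa only [sub_eq_add_neg] using (tendsto_add_const_codiscrete (-a)).eventually h

lemma eventually_theta_sub_ne_zero (hτ : 0 < τ.im) (a : ℂ) :
    ∀ᶠ l in codiscrete ℂ, theta τ (l - a) ≠ 0 :=
  eventually_codiscrete_sub_const (eventually_theta_ne_zero hτ) a

lemma eventually_theta_const_sub_ne_zero (hτ : 0 < τ.im) (a : ℂ) :
    ∀ᶠ l in codiscrete ℂ, theta τ (a - l) ≠ 0 := by
  filter_upwards [eventually_theta_sub_ne_zero hτ a] with l hl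
  rwa [← neg_sub, theta_neg, neg_ne_zero]

lemma exists_eq_const_mul_of_wronskian_eq_zero {f g f' g' : ℂ → ℂ}
    (hf : ∀ x, HasDerivAt f (f' x) x) (hg : ∀ x, HasDerivAt g (g' x) x)
    (h : ∀ x, f' x * g x - f x * g' x = 0) {x₀ : ℂ} (hx₀ : g x₀ ≠ 0) :
    ∃ C, ∀ x, f x = C * g x := by
  have hfd : Differentiable ℂ f := fun x => (hf x).differentiableAt
  have hgd : Differentiable ℂ g := fun x => (hg x).differentiableAt
  obtain ⟨r, hr, hball⟩ := Metric.eventually_nhds_iff_ball.1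
    (hgd.continuous.continuousAt.eventually_ne hx₀)
  have hquot (z : ℂ) (hz : z ∈ Metric.ball x₀ r) : HasDerivAt (f / g) 0 z := by
    simpa [h z] using (hf z).div (hg z) (hball z hz)
  refine ⟨f x₀ / g x₀, congrFun <| AnalyticOnNhd.eq_of_eventuallyEq (𝕜 := ℂ) (z₀ := x₀)
    (fun x _ => hfd.analyticAt x) (fun x _ => (hgd.const_mul _).analyticAt x) ?_⟩
  filter_upwards [Metric.ball_mem_nhds x₀ hr] with y hy
  have hconst : (f / g) y = (f / g) x₀ :=
    Metric.isOpen_ball.is_const_of_deriv_eq_zero (convex_ball x₀ r).isPreconnected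
      (fun z hz => (hquot z hz).differentiableAt.differentiableWithinAt)
      (fun z hz => (hquot z hz).deriv) hy (Metric.mem_ball_self hr)
  rw [← Pi.div_apply, ← hconst, Pi.div_apply, div_mul_cancel₀ _ (hball y hy)]

lemma deriv_theta_zero_ne_zero (hτ : 0 < τ.im) : deriv (theta τ) 0 ≠ 0 := by
  intro h0
  have hθ (x) := (differentiable_theta hτ x).hasDerivAt
  have hE (x) := (differentiable_thetaEven hτ x).hasDerivAt
  have hO (x) := (differentiable_thetaOdd hτ x).hasDerivAt
  -- Differentiate the product formula in `x` at `x = y`.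
  have hw (y) :
      deriv (thetaOdd τ) y * thetaEven τ y - thetaOdd τ y * deriv (thetaEven τ) y = 0 := by
    have hl := ((hθ (y + y)).comp_add_const y y).fun_mul ((hθ (y - y)).comp_sub_const y y)
    have hr := ((hO y).mul_const (thetaEven τ y)).fun_sub ((hE y).mul_const (thetaOdd τ y))
    simp only [theta_mul_theta hτ] at hl
    have := hl.unique hr
    rw [sub_self, theta_zero, h0] at this
    linear_combination -this
  obtain ⟨t, ht⟩ := exists_theta_ne_zero hτ
  refine mul_self_ne_zero.2 ht ?_
  have hprod := theta_mul_theta hτ t 0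
  rw [add_zero, sub_zero] at hprod
  rw [hprod]
  by_cases h : ∃ x₀, thetaEven τ x₀ ≠ 0
  · obtain ⟨x₀, hx₀⟩ := h
    obtain ⟨C, hC⟩ := exists_eq_const_mul_of_wronskian_eq_zero hO hE hw hx₀
    rw [hC, hC]; ring
  · push Not at h
    simp only [h, mul_zero, zero_mul, sub_zero]

/-- The quasi-periods of `theta τ`: pairs `(ω, k)` such that translation by `ω` multiplies `theta τ`
by `C * exp (k * t)` for some constant `C ≠ 0`. -/
def quasiPeriods (τ : ℂ) : AddSubgroup (ℂ × ℂ) where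
  carrier := {x | ∃ C ≠ 0, ∀ t, theta τ (t + x.1) = C * exp (x.2 * t) * theta τ t}
  zero_mem' := ⟨1, one_ne_zero, fun t => by simp⟩
  add_mem' := by
    rintro ⟨ω, k⟩ ⟨ω', k'⟩ ⟨C, hC, h⟩ ⟨C', hC', h'⟩
    refine ⟨C * C' * exp (k' * ω), by simp [hC, hC'], fun t => ?_⟩
    simp only [Prod.mk_add_mk] at h h' ⊢
    rw [show t + (ω + ω') = t + ω + ω' by ring, h', h, mul_add, Complex.exp_add,
      add_mul, Complex.exp_add]
    ring
  neg_mem' := by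
    rintro ⟨ω, k⟩ ⟨C, hC, h⟩
    refine ⟨C⁻¹ * exp (k * ω), by simp [hC], fun t => ?_⟩
    have ht := h (t + -ω)
    simp only [Prod.neg_mk, neg_add_cancel_right] at ht ⊢
    rw [ht, show k * (t + -ω) = k * t - k * ω by ring, Complex.exp_sub, neg_mul, Complex.exp_neg]
    field_simp

lemma one_mem_quasiPeriods : ((1, 0) : ℂ × ℂ) ∈ quasiPeriods τ :=
  ⟨-1, by simp, fun t => by simp [theta_add_one]⟩

lemma tau_mem_quasiPeriods : (τ, -(2 * π * I)) ∈ quasiPeriods τ := by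
  refine ⟨-exp (-(π * I * τ)), by simp, fun t => ?_⟩
  rw [theta_add_tau, neg_mul (exp (-(π * I * τ))), ← Complex.exp_add]
  congr 3; ring

lemma lattice_mem_quasiPeriods (r s : ℤ) :
    ((r + s * τ, -(2 * π * I * s)) : ℂ × ℂ) ∈ quasiPeriods τ := by
  have := add_mem (zsmul_mem (one_mem_quasiPeriods (τ := τ)) r)
    (zsmul_mem (tau_mem_quasiPeriods (τ := τ)) s)
  simpa [mul_comm] using this

lemma exp_eq_one_of_mem_quasiPeriods (hτ : 0 < τ.im) {x y : ℂ × ℂ} (hx : x ∈ quasiPeriods τ)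
    (hy : y ∈ quasiPeriods τ) : exp (x.2 * y.1 - y.2 * x.1) = 1 := by
  obtain ⟨C, hC, h⟩ := hx
  obtain ⟨C', hC', h'⟩ := hy
  obtain ⟨t, ht⟩ := exists_theta_ne_zero hτ
  have hcomm := h' (t + x.1)
  rw [show t + x.1 + y.1 = t + y.1 + x.1 by ring, h, h, h', mul_add, mul_add, Complex.exp_add,
    Complex.exp_add] at hcomm
  rw [Complex.exp_sub, div_eq_one_iff_eq (Complex.exp_ne_zero _)]
  refine mul_left_cancel₀ (mul_ne_zero (mul_ne_zero (mul_ne_zero hC hC')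
    (mul_ne_zero (exp_ne_zero (x.2 * t)) (exp_ne_zero (y.2 * t)))) ht) ?_
  linear_combination hcomm

lemma hasDerivAt_comp_add_mul_comp_sub {f : ℂ → ℂ} (hf : Differentiable ℂ f) (p q : ℂ) :
    HasDerivAt (fun s => f (p + s) * f (q - s)) (deriv f p * f q - f p * deriv f q) 0 := by
  have hp : HasDerivAt (fun s => f (p + s)) (deriv f p) 0 := by
    simpa using (hf (p + 0)).hasDerivAt.comp_const_add p 0
  have hq : HasDerivAt (fun s => f (q - s)) (-deriv f q) 0 := by
    simpa using (hf (q - 0)).hasDerivAt.comp_const_sub q 0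
  simpa [sub_eq_add_neg] using hp.fun_mul hq

/-- The hypothesis says that `f(p) f(q) / (g(p) g(q))` depends only on `p + q`, so that the
logarithmic derivative of `f / g` is constant. -/
lemma exists_eq_const_mul_exp_mul {f g : ℂ → ℂ} (hf : Differentiable ℂ f) (hg : Differentiable ℂ g)
    (h : ∀ p q s, f (p + s) * f (q - s) * (g p * g q) = f p * f q * (g (p + s) * g (q - s)))
    {x₀ : ℂ} (hfx₀ : f x₀ ≠ 0) (hgx₀ : g x₀ ≠ 0) : ∃ C k, ∀ x, f x = C * exp (k * x) * g x := by
  set k := deriv f x₀ / f x₀ - deriv g x₀ / g x₀ with hk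
  have hw (p) : deriv f p * g p - f p * deriv g p = k * (f p * g p) := by
    have hl := (hasDerivAt_comp_add_mul_comp_sub hf p x₀).mul_const (g p * g x₀)
    have hr := (hasDerivAt_comp_add_mul_comp_sub hg p x₀).const_mul (f p * f x₀)
    have := hl.unique (by simpa only [h p x₀] using hr)
    rw [hk]
    field_simp
    linear_combination this
  have hfe (x) : HasDerivAt (fun x => f x * exp (-k * x))
      (deriv f x * exp (-k * x) + f x * (exp (-k * x) * -k)) x :=
    (hf x).hasDerivAt.mul (by simpa using ((hasDerivAt_id x).const_mul (-k)).cexp)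
  obtain ⟨C, hC⟩ := exists_eq_const_mul_of_wronskian_eq_zero hfe
    (fun x => (hg x).hasDerivAt) (fun x => by linear_combination exp (-k * x) * hw x) hgx₀
  refine ⟨C, k, fun x => ?_⟩
  rw [mul_right_comm, ← hC, mul_assoc, ← Complex.exp_add]
  simp

lemma theta_add_mul_theta_add (hτ : 0 < τ.im) {a : ℂ} (ha : theta τ a = 0) (p q s : ℂ) :
    theta τ (p + s + a) * theta τ (q - s + a) * (theta τ p * theta τ q) =
      theta τ (p + a) * theta τ (q + a) * (theta τ (p + s) * theta τ (q - s)) := by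
  set u := (p + q) / 2
  set d := (p - q) / 2
  have h0 := theta_mul_theta_of_eq hτ (s := u + a + u) (t := a) (x := u + a) (y := u) rfl (by ring)
  have hpqa := theta_mul_theta_of_eq hτ (s := p + a) (t := q + a) (x := u + a) (y := d)
    (by ring) (by ring)
  have hpqsa := theta_mul_theta_of_eq hτ (s := p + s + a) (t := q - s + a) (x := u + a) (y := d + s)
    (by ring) (by ring)
  have hpq := theta_mul_theta_of_eq hτ (s := p) (t := q) (x := u) (y := d) (by ring) (by ring)
  have hpqs := theta_mul_theta_of_eq hτ (s := p + s) (t := q - s) (x := u) (y := d + s)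
    (by ring) (by ring)
  rw [ha, mul_zero] at h0
  rw [hpqa, hpqsa, hpq, hpqs]
  linear_combination (thetaOdd τ d * thetaEven τ (d + s)
    - thetaEven τ d * thetaOdd τ (d + s)) * h0

lemma exists_mem_quasiPeriods_of_theta_eq_zero (hτ : 0 < τ.im) {a : ℂ} (ha : theta τ a = 0) :
    ∃ k, (a, k) ∈ quasiPeriods τ := by
  have hθ := differentiable_theta hτ
  obtain ⟨x₀, hx₀, hx₀a⟩ := ((eventually_theta_ne_zero hτ).and
    ((tendsto_add_const_codiscrete a).eventually (eventually_theta_ne_zero hτ))).exists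
  obtain ⟨C, k, hCk⟩ := exists_eq_const_mul_exp_mul (f := fun p => theta τ (p + a))
    (hθ.comp (by fun_prop)) hθ (theta_add_mul_theta_add hτ ha) hx₀a hx₀
  refine ⟨k, C, fun hC => hx₀a ?_, hCk⟩
  rw [hCk, hC, zero_mul, zero_mul]

/-- A zero of `theta` is a quasi-period, and the Legendre relations with the quasi-periods `1` and
`τ` place it in the lattice. -/
theorem mem_lattice_of_theta_eq_zero (hτ : 0 < τ.im) {a : ℂ} (ha : theta τ a = 0) :
    ∃ r s : ℤ, a = r + s * τ := by
  obtain ⟨k, hk⟩ := exists_mem_quasiPeriods_of_theta_eq_zero hτ ha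
  obtain ⟨s, hs⟩ := Complex.exp_eq_one_iff.1
    (exp_eq_one_of_mem_quasiPeriods hτ hk one_mem_quasiPeriods)
  obtain ⟨r, hr⟩ := Complex.exp_eq_one_iff.1
    (exp_eq_one_of_mem_quasiPeriods hτ hk tau_mem_quasiPeriods)
  refine ⟨r, -s, mul_left_cancel₀ two_pi_I_ne_zero ?_⟩
  push_cast
  linear_combination hr - τ * hs

end Theta

section Generic

variable {X : Type*} [TopologicalSpace X]

lemma residual_le_codiscrete [PerfectSpace X] : residual X ≤ codiscrete X := by
  intro s hs
  refine residual_of_dense_open (mem_codiscrete'.1 hs).1 fun x => ?_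
  have : ∃ᶠ y in 𝓝[≠] x, y ∈ s := Eventually.frequently (nhdsNE_le_codiscrete x hs)
  exact mem_closure_iff_frequently.2 (this.filter_mono nhdsWithin_le_nhds)

lemma tendsto_residual_codiscrete {Y : Type*} [TopologicalSpace Y] [PerfectSpace Y] {g : X → Y}
    (hc : Continuous g) (ho : IsOpenMap g) : Tendsto g (residual X) (codiscrete Y) :=
  (tendsto_residual_of_isOpenMap hc ho).mono_right residual_le_codiscrete

lemma tendsto_fst_residual_codiscrete :
    Tendsto Prod.fst (residual (ℂ × ℂ)) (codiscrete ℂ) :=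
  tendsto_residual_codiscrete continuous_fst isOpenMap_fst

lemma tendsto_snd_residual_codiscrete :
    Tendsto Prod.snd (residual (ℂ × ℂ)) (codiscrete ℂ) :=
  tendsto_residual_codiscrete continuous_snd isOpenMap_snd

lemma eventually_residual_of_dense_interior {p : X → Prop} (h : Dense (interior {x | p x})) :
    ∀ᶠ x in residual X, p x :=
  mem_of_superset (residual_of_dense_open isOpen_interior h) interior_subset

lemma eventually_codiscrete_nhds {p : X → Prop} (h : ∀ᶠ x in codiscrete X, p x) :
    ∀ᶠ x in codiscrete X, ∀ᶠ y in 𝓝 x, p y :=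
  mem_of_superset h fun _ hx => (mem_codiscrete'.1 h).1.mem_nhds hx

lemma tendsto_snd_add_residual (a : ℂ) :
    Tendsto (fun x : ℂ × ℂ => (x.1, x.2 + a)) (residual (ℂ × ℂ)) (residual (ℂ × ℂ)) :=
  let e := (Homeomorph.refl ℂ).prodCongr (Homeomorph.addRight a)
  tendsto_residual_of_isOpenMap e.continuous e.isOpenMap

end Generic

section VContAt

variable {X Y W : Type*} [TopologicalSpace X] [TopologicalSpace Y] [AddCommGroup W] [Module ℂ W]

/-- Continuity at `x` of a function with values in a vector space without topology: near `x` the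
function is a finite combination of fixed vectors with coefficients continuous at `x`. -/
def VContAt (F : X → W) (x : X) : Prop :=
  ∃ (ι : Type) (_ : Fintype ι) (f : ι → X → ℂ) (u : ι → W),
    (∀ i, ContinuousAt (f i) x) ∧ ∀ᶠ y in 𝓝 x, F y = ∑ i, f i y • u i

namespace VContAt

variable {F G : X → W} {x : X}

lemma of_eventually_eq_sum {ι : Type} [Fintype ι] {f : ι → X → ℂ} {u : ι → W}
    (hf : ∀ i, ContinuousAt (f i) x) (h : ∀ᶠ y in 𝓝 x, F y = ∑ i, f i y • u i) : VContAt F x :=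
  ⟨ι, inferInstance, f, u, hf, h⟩

lemma congr (hF : VContAt F x) (h : ∀ᶠ y in 𝓝 x, G y = F y) : VContAt G x := by
  obtain ⟨ι, _, f, u, hf, hFf⟩ := hF
  exact of_eventually_eq_sum hf (by filter_upwards [h, hFf] with y h1 h2 using h1.trans h2)

lemma zero (x : X) : VContAt (fun _ => (0 : W)) x :=
  of_eventually_eq_sum (ι := Empty) (f := fun i => i.elim) (u := fun i => i.elim)
    (fun i => i.elim) (by simp)

lemma add (hF : VContAt F x) (hG : VContAt G x) : VContAt (fun y => F y + G y) x := by
  obtain ⟨ι, _, f, u, hf, hFf⟩ := hF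
  obtain ⟨κ, _, g, v, hg, hGg⟩ := hG
  refine of_eventually_eq_sum (ι := ι ⊕ κ) (f := Sum.elim f g) (u := Sum.elim u v) ?_ ?_
  · rintro (i | i)
    exacts [hf i, hg i]
  · filter_upwards [hFf, hGg] with y h1 h2
    simp [h1, h2]

lemma smul {g : X → ℂ} (hg : ContinuousAt g x) (hF : VContAt F x) :
    VContAt (fun y => g y • F y) x := by
  obtain ⟨ι, _, f, u, hf, hFf⟩ := hF
  refine of_eventually_eq_sum (f := fun i y => g y * f i y) (u := u) (fun i => hg.mul (hf i)) ?_
  filter_upwards [hFf] with y h1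
  simp only [h1, Finset.smul_sum, mul_smul]

lemma sum {κ : Type*} (s : Finset κ) {F : κ → X → W} (h : ∀ i ∈ s, VContAt (F i) x) :
    VContAt (fun y => ∑ i ∈ s, F i y) x := by
  classical
  induction s using Finset.induction_on with
  | empty => simpa only [Finset.sum_empty] using zero x
  | insert a s ha ih =>
    simp only [Finset.sum_insert ha]
    exact (h a (Finset.mem_insert_self a s)).add (ih fun i hi => h i (Finset.mem_insert_of_mem hi))

lemma comp {g : Y → X} {y : Y} (hF : VContAt F (g y)) (hg : ContinuousAt g y) :
    VContAt (fun y => F (g y)) y := by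
  obtain ⟨ι, _, f, u, hf, hFf⟩ := hF
  exact of_eventually_eq_sum (f := fun i y => f i (g y)) (fun i => (hf i).comp hg)
    (hg.eventually hFf)

lemma continuousAt_dual (hF : VContAt F x) (φ : Module.Dual ℂ W) :
    ContinuousAt (fun y => φ (F y)) x := by
  obtain ⟨ι, _, f, u, hf, hFf⟩ := hF
  have h : ContinuousAt (fun y => ∑ i, f i y * φ (u i)) x :=
    tendsto_finsetSum _ fun i _ => (hf i).mul continuousAt_const
  refine h.congr ?_
  filter_upwards [hFf] with y hy
  simp only [hy, map_sum, map_smul, smul_eq_mul]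

lemma eq_of_residual [BaireSpace X] (hF : VContAt F x) (hG : VContAt G x)
    (h : ∀ᶠ y in residual X, F y = G y) : F x = G x := by
  rw [← sub_eq_zero, ← Module.forall_dual_apply_eq_zero_iff ℂ]
  intro φ
  rw [map_sub, sub_eq_zero]
  let S := {y | F y = G y}
  have : (𝓝[S] x).NeBot := mem_closure_iff_nhdsWithin_neBot.1 (dense_of_mem_residual h x)
  refine tendsto_nhds_unique
    ((hF.continuousAt_dual φ).mono_left (nhdsWithin_le_nhds (s := S)))
    (((hG.continuousAt_dual φ).mono_left nhdsWithin_le_nhds).congr' ?_)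
  filter_upwards [self_mem_nhdsWithin] with y hy
  exact congrArg φ (Eq.symm hy)

lemma exists_mem_submodule (hF : VContAt F x) {U : Submodule ℂ W} (hU : ∀ᶠ y in 𝓝 x, F y ∈ U) :
    ∃ (ι : Type) (_ : Fintype ι) (f : ι → X → ℂ) (u : ι → U),
      (∀ i, ContinuousAt (f i) x) ∧ ∀ᶠ y in 𝓝 x, F y = ∑ i, f i y • (u i : W) := by
  obtain ⟨ι, _, f, u, hf, hFf⟩ := hF
  obtain ⟨P, hP⟩ := U.subtype.exists_leftInverse_of_injective U.ker_subtype
  refine ⟨ι, inferInstance, f, fun i => P (u i), hf, ?_⟩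
  filter_upwards [hFf, hU] with y h1 h2
  have h3 : P (F y) = ⟨F y, h2⟩ := LinearMap.congr_fun hP ⟨F y, h2⟩
  calc F y = (P (F y) : W) := by rw [h3]
    _ = ∑ i, f i y • (P (u i) : W) := by
      simp only [h1, map_sum, map_smul, Submodule.coe_sum, Submodule.coe_smul]

lemma apply {A : X → Module.End ℂ W} (hF : VContAt F x) {U : Submodule ℂ W}
    (hU : ∀ᶠ y in 𝓝 x, F y ∈ U) (hA : ∀ u ∈ U, VContAt (fun y => A y u) x) :
    VContAt (fun y => A y (F y)) x := by
  obtain ⟨ι, _, f, u, hf, hFf⟩ := hF.exists_mem_submodule hU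
  refine congr (sum Finset.univ (F := fun i y => f i y • A y (u i))
    fun i _ => smul (hf i) (hA _ (u i).2)) ?_
  filter_upwards [hFf] with y hy
  simp only [hy, map_sum, map_smul]

lemma apply_of_basis {A : X → Module.End ℂ W} {U : Submodule ℂ W} {κ : Type*} [Finite κ]
    (e : Module.Basis κ ℂ U) (h : ∀ i, VContAt (fun y => A y (e i : W)) x) {u : W} (hu : u ∈ U) :
    VContAt (fun y => A y u) x := by
  cases nonempty_fintype κ
  have h1 : u = ∑ i, e.repr ⟨u, hu⟩ i • (e i : W) := by
    simpa only [Submodule.coe_sum, Submodule.coe_smul] using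
      congrArg Subtype.val (e.sum_repr ⟨u, hu⟩).symm
  refine congr (sum Finset.univ (F := fun i y => e.repr ⟨u, hu⟩ i • A y (e i : W))
    fun i _ => smul continuousAt_const (h i)) (Eventually.of_forall fun y => ?_)
  conv_lhs => rw [h1]
  simp only [map_sum, map_smul]

end VContAt

end VContAt

section Mero

variable {W : Type*} [AddCommGroup W] [Module ℂ W]

lemma HolAt.vcontAt {F : ℂ × ℂ → W} {x : ℂ × ℂ} (h : HolAt F x) : VContAt F x := by
  obtain ⟨k, f, u, hf, h⟩ := h
  exact VContAt.of_eventually_eq_sum (fun i => (hf i).continuousAt) h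

lemma eventually_continuousAt_of_meromorphic {f : ℂ → ℂ} (hf : Meromorphic f) :
    ∀ᶠ l in codiscrete ℂ, ContinuousAt f l :=
  (MeromorphicOn.eventually_codiscreteWithin_analyticAt f fun x _ => hf x).mono
    fun _ h => h.continuousAt

lemma MeroFun.eventually_vcontAt {F : ℂ → W} (h : MeroFun F) :
    ∀ᶠ l in codiscrete ℂ, VContAt F l := by
  obtain ⟨k, f, u, hf, h⟩ := h
  filter_upwards [eventually_all.2 fun i => eventually_continuousAt_of_meromorphic (hf i)] with l hl
  exact VContAt.of_eventually_eq_sum hl (Eventually.of_forall h)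

lemma MeroFun.eventually_vcontAt_snd {f : ℂ → W} (hf : MeroFun f) (z : ℂ) :
    ∀ᶠ l in codiscrete ℂ, VContAt (fun y : ℂ × ℂ => f y.2) (z, l) :=
  hf.eventually_vcontAt.mono fun _ hl => VContAt.comp (g := Prod.snd) hl continuousAt_snd

lemma Meromorphic₂.eventually_continuousAt {f : ℂ × ℂ → ℂ} (hf : Meromorphic₂ f) :
    ∀ᶠ x in residual (ℂ × ℂ), ContinuousAt f x := by
  refine eventually_residual_of_dense_interior fun x => ?_
  obtain ⟨g, h, hg, hh, h0, hfgh⟩ := hf x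
  rw [mem_closure_iff_frequently]
  have hfreq : ∃ᶠ y in 𝓝 x, h y ≠ 0 := not_eventually.1 h0
  refine (hfreq.and_eventually (hg.eventually_analyticAt.and
    (hh.eventually_analyticAt.and hfgh)).eventually_nhds).mono ?_
  rintro y ⟨hy0, hy⟩
  have hne : ∀ᶠ y' in 𝓝 y, h y' ≠ 0 := hy.self_of_nhds.2.1.continuousAt.eventually_ne hy0
  rw [mem_interior_iff_mem_nhds]
  filter_upwards [hy.eventually_nhds, hne.eventually_nhds] with y' h1 h2
  refine (h1.self_of_nhds.1.continuousAt.div h1.self_of_nhds.2.1.continuousAt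
    h2.self_of_nhds).congr ?_
  filter_upwards [h1, h2] with y'' h3 h4 using (h3.2.2 h4).symm

lemma MeroFun₂.eventually_vcontAt {F : ℂ × ℂ → W} (h : MeroFun₂ F) :
    ∀ᶠ x in residual (ℂ × ℂ), VContAt F x := by
  obtain ⟨k, f, u, hf, h⟩ := h
  filter_upwards [eventually_all.2 fun i => (hf i).eventually_continuousAt] with l hl
  exact VContAt.of_eventually_eq_sum hl (Eventually.of_forall h)

lemma MeroFun.of_fintype {F : ℂ → W} {ι : Type*} [Fintype ι] {f : ι → ℂ → ℂ} {u : ι → W}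
    (hf : ∀ i, Meromorphic (f i)) (h : ∀ x, F x = ∑ i, f i x • u i) : MeroFun F := by
  let e := Fintype.equivFin ι
  refine ⟨Fintype.card ι, fun i => f (e.symm i), fun i => u (e.symm i), fun i => hf _, fun x => ?_⟩
  rw [h, ← e.symm.sum_comp]

lemma meromorphic_comp_add_const {f : ℂ → ℂ} (hf : Meromorphic f) (a : ℂ) :
    Meromorphic fun x => f (x + a) := fun x =>
  MeromorphicAt.comp_analyticAt (g := fun x : ℂ => x + a) (hf (x + a)) (by fun_prop)

lemma MeroFun.smul {F : ℂ → W} (hF : MeroFun F) {g : ℂ → ℂ} (hg : Meromorphic g) :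
    MeroFun fun x => g x • F x := by
  obtain ⟨k, f, u, hf, h⟩ := hF
  refine ⟨k, fun i x => g x * f i x, u, fun i x => (hg x).mul (hf i x), fun x => ?_⟩
  simp only [h, Finset.smul_sum, mul_smul]

end Mero

section Commutation

@[simp] lemma wt_zero : wt 0 = 1 := by simp [wt]

@[simp] lemma wt_one : wt 1 = -1 := by simp [wt]

lemma exists_wt_sub_wt (i j : Fin 2) : ∃ r : ℤ, wt i - wt j = 2 * r := by
  fin_cases i <;> fin_cases j
  · exact ⟨0, by simp⟩
  · exact ⟨1, by norm_num⟩
  · exact ⟨-1, by norm_num⟩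
  · exact ⟨0, by simp⟩

variable {τ η : ℂ}

lemma mul_alpha_neg {z l : ℂ} (hl : theta τ l ≠ 0) (hz : theta τ (z - 2 * η) ≠ 0) :
    theta τ l * theta τ (z - 2 * η) * alpha τ η z (-l) = theta τ (l - 2 * η) * theta τ z := by
  rw [alpha, show -l + 2 * η = -(l - 2 * η) by ring, theta_neg, theta_neg]
  field_simp

lemma mul_beta {z l : ℂ} (hl : theta τ l ≠ 0) (hz : theta τ (z - 2 * η) ≠ 0) :
    theta τ l * theta τ (z - 2 * η) * beta τ η z l = -(theta τ (l + z) * theta τ (2 * η)) := by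
  rw [beta]
  field_simp

lemma mul_beta_neg {z l : ℂ} (hl : theta τ l ≠ 0) (hz : theta τ (z - 2 * η) ≠ 0) :
    theta τ l * theta τ (z - 2 * η) * beta τ η z (-l) =
      -(theta τ (l - z) * theta τ (2 * η)) := by
  rw [beta, show -l + z = -(l - z) by ring, theta_neg, theta_neg]
  field_simp

lemma eventually_residual_theta_ne_zero (hτ : 0 < τ.im) {f : ℂ × ℂ × ℂ →L[ℂ] ℂ}
    (hf : Function.Surjective f) (a : ℂ) :
    ∀ᶠ y in residual (ℂ × ℂ × ℂ), theta τ (f y - a) ≠ 0 :=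
  (tendsto_residual_codiscrete (g := fun y => f y - a) (by fun_prop)
    ((Homeomorph.subRight a).isOpenMap.comp (f.isOpenMap hf))).eventually
    (eventually_theta_ne_zero hτ)

lemma eventually_residual_theta_dynamical_ne_zero (hτ : 0 < τ.im) (a : ℂ) :
    ∀ᶠ y in residual (ℂ × ℂ × ℂ), theta τ (y.2.2 - a) ≠ 0 :=
  eventually_residual_theta_ne_zero hτ
    (f := (ContinuousLinearMap.snd ℂ ℂ ℂ).comp (ContinuousLinearMap.snd ℂ ℂ (ℂ × ℂ)))
    (fun z => ⟨(0, 0, z), rfl⟩) a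

lemma eventually_residual_theta_spectral_ne_zero (hτ : 0 < τ.im) (a : ℂ) :
    ∀ᶠ y in residual (ℂ × ℂ × ℂ), theta τ (y.1 - y.2.1 - a) ≠ 0 :=
  eventually_residual_theta_ne_zero hτ (f := ContinuousLinearMap.fst ℂ ℂ (ℂ × ℂ) -
    (ContinuousLinearMap.fst ℂ ℂ ℂ).comp (ContinuousLinearMap.snd ℂ ℂ (ℂ × ℂ)))
    (fun z => ⟨(z, 0, 0), sub_zero z⟩) a

lemma tendsto_swap_residual :
    Tendsto (fun y : ℂ × ℂ × ℂ => (y.2.1, y.1, y.2.2)) (residual _) (residual _) :=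
  let e : ℂ × ℂ × ℂ ≃ₜ ℂ × ℂ × ℂ :=
    ⟨⟨fun y => (y.2.1, y.1, y.2.2), fun y => (y.2.1, y.1, y.2.2), fun _ => rfl, fun _ => rfl⟩,
      by fun_prop, by fun_prop⟩
  tendsto_residual_of_isOpenMap e.continuous e.isOpenMap

/-- The argument of the theta functions in the exchange relation of `b` with the `j`-th diagonal
entry of `L̃`, acting on vectors of weight `μ`: it is `λ` for `a` (`j = 0`) and `λ - 2ημ`, the value
of `λ - 2ηh`, for `d` (`j = 1`). -/
def dynParam (η : ℂ) (j : Fin 2) (μ l : ℂ) : ℂ := l - 2 * η * (if j = 0 then 0 else μ)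

namespace EModule

variable {W : Type*} [AddCommGroup W] [Module ℂ W] (M : EModule τ η W)

/-- `L` is continuous at `(z, l + 2ηs)` on the weight spaces of weight `μ + 2r`, for all integers
`r` and `s`: these are all the values of `L` that occur in products of operators `a`, `b`, `c`, `d`
applied to a vector of weight `μ`. -/
def LContAt (μ z l : ℂ) : Prop :=
  ∀ (r s : ℤ) (i j : Fin 2), ∀ u ∈ M.h.eigenspace (μ + 2 * r),
    VContAt (fun y : ℂ × ℂ => M.L y.1 y.2 i j u) (z, l + 2 * η * s)

lemma eventually_forall_mem_eigenspace {X : Type*} {F : Filter X} {g : X → ℂ × ℂ} (μ : ℂ)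
    (i j : Fin 2) (h : ∀ u, ∀ᶠ x in F, VContAt (fun y : ℂ × ℂ => M.L y.1 y.2 i j u) (g x)) :
    ∀ᶠ x in F, ∀ u ∈ M.h.eigenspace μ,
      VContAt (fun y : ℂ × ℂ => M.L y.1 y.2 i j u) (g x) := by
  have := M.finite_weight μ
  have e := Module.finBasis ℂ (M.h.eigenspace μ)
  filter_upwards [eventually_all.2 fun k => h (e k)] with x hx u hu
  exact VContAt.apply_of_basis (A := fun y : ℂ × ℂ => M.L y.1 y.2 i j) e hx hu

lemma eventually_lContAt_of {s : ℂ → ℂ} (μ : ℂ) (hs : ∀ i j u, ∀ᶠ x in residual (ℂ × ℂ),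
      VContAt (fun y : ℂ × ℂ => M.L y.1 y.2 i j u) (s x.1, x.2)) :
    ∀ᶠ x in residual (ℂ × ℂ), M.LContAt μ (s x.1) x.2 := by
  simp only [LContAt, eventually_countable_forall]
  intro r k i j
  exact (tendsto_snd_add_residual (2 * η * k)).eventually
    (M.eventually_forall_mem_eigenspace (g := fun x => (s x.1, x.2)) (μ + 2 * r) i j
      fun u => hs i j u)

lemma eventually_lContAt (μ : ℂ) : ∀ᶠ x in residual (ℂ × ℂ), M.LContAt μ x.1 x.2 :=
  M.eventually_lContAt_of (s := id) μ fun i j u => (M.L_mero i j u).eventually_vcontAt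

variable {M}

lemma IsRegular.eventually_lContAt {z : ℂ} (hz : M.IsRegular z) (μ : ℂ) :
    ∀ᶠ x in residual (ℂ × ℂ), M.LContAt μ z x.2 :=
  M.eventually_lContAt_of (s := fun _ => z) μ fun i j u =>
    tendsto_snd_residual_codiscrete.eventually ((hz i j u).2.mono fun _ h => h.vcontAt)

lemma LContAt.vcontAt_comp {μ : ℂ} {y₀ : ℂ × ℂ × ℂ} {ζ ω : ℂ × ℂ × ℂ → ℂ}
    (hz : M.LContAt μ (ζ y₀) y₀.2.2) (hw : M.LContAt μ (ω y₀) y₀.2.2) (hζ : Continuous ζ)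
    (hω : Continuous ω) (s s' : ℤ) (k i l j : Fin 2) {u : W} (hu : u ∈ M.h.eigenspace μ) :
    VContAt (fun y : ℂ × ℂ × ℂ => M.L (ζ y) (y.2.2 + 2 * η * s) k i
      (M.L (ω y) (y.2.2 + 2 * η * s') l j u)) y₀ := by
  obtain ⟨r, hr⟩ := exists_wt_sub_wt j l
  refine VContAt.apply (A := fun y : ℂ × ℂ × ℂ => M.L (ζ y) (y.2.2 + 2 * η * s) k i)
    (F := fun y : ℂ × ℂ × ℂ => M.L (ω y) (y.2.2 + 2 * η * s') l j u)
    (U := M.h.eigenspace (μ + 2 * r)) ?_ ?_ ?_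
  · exact VContAt.comp (F := fun y : ℂ × ℂ => M.L y.1 y.2 l j u)
      (g := fun y : ℂ × ℂ × ℂ => (ω y, y.2.2 + 2 * η * s'))
      (hw 0 s' l j u (by simpa using hu)) (by fun_prop)
  · refine Eventually.of_forall fun y => ?_
    have := M.L_weight (ω y) (y.2.2 + 2 * η * s') l j μ u hu
    rwa [add_sub_assoc, hr] at this
  · intro v hv
    exact VContAt.comp (F := fun y : ℂ × ℂ => M.L y.1 y.2 k i v)
      (g := fun y : ℂ × ℂ × ℂ => (ζ y, y.2.2 + 2 * η * s)) (hz r s k i v hv) (by fun_prop)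

lemma eventually_RLL (M : EModule τ η W) (i j i' j' : Fin 2) (μ : ℂ) {u : W}
    (hu : u ∈ M.h.eigenspace μ) : ∀ᶠ y in residual (ℂ × ℂ × ℂ),
      ∑ k, ∑ l, R τ η (y.1 - y.2.1) (y.2.2 - 2 * η * (μ + wt i + wt j - wt k - wt l))
          (i', j') (k, l) • M.L y.1 y.2.2 k i (M.L y.2.1 (y.2.2 - 2 * η * wt i) l j u)
        = ∑ k, ∑ l, R τ η (y.1 - y.2.1) y.2.2 (k, l) (i, j) •
          M.L y.2.1 y.2.2 j' l (M.L y.1 (y.2.2 - 2 * η * wt l) i' k u) :=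
  (eventually_residual_of_dense_interior (M.RLL i j i' j' μ u hu)).mono fun y hy =>
    hy y.1 y.2.1 y.2.2 rfl

lemma LContAt.b_comm {μ z w l : ℂ} (hz : M.LContAt μ z l) (hw : M.LContAt μ w l) {u : W}
    (hu : u ∈ M.h.eigenspace μ) :
    M.L z l 0 1 (M.L w (l + 2 * η) 0 1 u) = M.L w l 0 1 (M.L z (l + 2 * η) 0 1 u) := by
  have h1 := LContAt.vcontAt_comp (y₀ := (z, w, l)) (ζ := fun y => y.1) (ω := fun y => y.2.1)
    hz hw (by fun_prop) (by fun_prop) 0 1 0 1 0 1 hu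
  have h2 := LContAt.vcontAt_comp (y₀ := (z, w, l)) (ζ := fun y => y.2.1) (ω := fun y => y.1)
    hw hz (by fun_prop) (by fun_prop) 0 1 0 1 0 1 hu
  have := h1.eq_of_residual h2 ?_
  · simpa using this
  filter_upwards [eventually_RLL M 1 1 0 0 μ hu] with y hy
  simpa [R, E, Matrix.single_apply, Fin.sum_univ_two] using hy

variable (M) in
/-- The exchange relation at `(s, t, l)` between the `j`-th diagonal entry of `L̃(s)` and `b(t)`,
on a vector `u` of weight `μ`. -/
def ExchangeRel (j : Fin 2) (μ : ℂ) (u : W) (s t l : ℂ) : Prop :=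
  let ν := dynParam η j (μ - 2) l
  let κ := 2 * η * wt j
  (theta τ (ν - 2 * η) * theta τ (t - s)) • M.L s l j j (M.L t (l - κ) 0 1 u) =
    (theta τ ν * theta τ (t - s - κ)) • M.L t l 0 1 (M.L s (l + 2 * η) j j u) +
    (theta τ (ν + (t - s)) * theta τ κ) • M.L s l 0 1 (M.L t (l + 2 * η) j j u)

lemma eventually_exchangeRel_zero (hτ : 0 < τ.im) {μ : ℂ} {u : W} (hu : u ∈ M.h.eigenspace μ) :
    ∀ᶠ y in residual (ℂ × ℂ × ℂ), M.ExchangeRel 0 μ u y.1 y.2.1 y.2.2 := by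
  suffices h : ∀ᶠ y in residual (ℂ × ℂ × ℂ), M.ExchangeRel 0 μ u y.2.1 y.1 y.2.2 from
    tendsto_swap_residual.eventually h
  filter_upwards [eventually_RLL M 1 0 0 0 μ hu, eventually_residual_theta_dynamical_ne_zero hτ 0,
    eventually_residual_theta_spectral_ne_zero hτ (2 * η)] with y hy hl hd
  rw [sub_zero] at hl
  simp only [R, E, Fin.isValue, wt_one, wt_zero, neg_add_cancel_right, neg_sub, Matrix.add_apply,
    Matrix.kroneckerMap_apply, Matrix.single_apply, true_and, mul_ite, mul_one, mul_zero,
    one_ne_zero, false_and, add_zero, Matrix.smul_apply, smul_eq_mul, ite_self, mul_neg,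
    sub_neg_eq_add, ite_smul, one_smul, zero_smul, Finset.sum_ite_eq, Finset.mem_univ,
    ↓reduceIte, zero_ne_one, and_false, and_true, zero_add, Fin.sum_univ_two] at hy
  simp only [ExchangeRel, dynParam, if_true, wt_zero, mul_zero, sub_zero, mul_one, hy, smul_add,
    smul_smul, mul_alpha_neg hl hd, mul_beta hl hd]
  module

lemma eventually_exchangeRel_one (hτ : 0 < τ.im) {μ : ℂ} {u : W} (hu : u ∈ M.h.eigenspace μ) :
    ∀ᶠ y in residual (ℂ × ℂ × ℂ), M.ExchangeRel 1 μ u y.1 y.2.1 y.2.2 := by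
  filter_upwards [eventually_RLL M 1 1 1 0 μ hu,
    eventually_residual_theta_dynamical_ne_zero hτ (2 * η * (μ - 2)),
    eventually_residual_theta_spectral_ne_zero hτ (2 * η)] with y hy hl hd
  simp only [R, E, Fin.isValue, wt_one, neg_sub, Matrix.add_apply, Matrix.kroneckerMap_apply,
    zero_ne_one, false_and, not_false_eq_true, Matrix.single_apply_of_ne, Matrix.single_apply,
    true_and, mul_ite, mul_one, mul_zero, ite_self, one_ne_zero, add_zero, Matrix.smul_apply,
    smul_eq_mul, zero_add, mul_neg, sub_neg_eq_add, Fin.sum_univ_two, ↓reduceIte, wt_zero,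
    ite_smul, zero_smul, sub_add_cancel, neg_add_cancel_right, and_false, and_true, one_smul,
    Finset.sum_ite_eq, Finset.mem_univ] at hy
  rw [show 2 * η * (μ + -1 + -1) - y.2.2 = -(y.2.2 - 2 * η * (μ - 2)) by ring,
    show 2 * η * (μ + -1 - 1) - y.2.2 = -(y.2.2 - 2 * η * (μ - 2)) by ring] at hy
  simp only [ExchangeRel, dynParam, one_ne_zero, if_false, wt_one, mul_neg, mul_one, sub_neg_eq_add,
    theta_neg]
  rw [show y.2.1 - y.1 = -(y.1 - y.2.1) by ring,
    show -(y.1 - y.2.1) + 2 * η = -(y.1 - y.2.1 - 2 * η) by ring, theta_neg, theta_neg]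
  simp only [← sub_eq_add_neg, mul_neg, neg_mul, neg_smul, ← hy, smul_add, smul_smul,
    mul_alpha_neg hl hd, mul_beta_neg hl hd]
  module

lemma LContAt.exchangeRel (hτ : 0 < τ.im) (j : Fin 2) {μ s t l : ℂ} (hs : M.LContAt μ s l)
    (ht : M.LContAt μ t l) {u : W} (hu : u ∈ M.h.eigenspace μ) : M.ExchangeRel j μ u s t l := by
  have hθ := continuous_theta hτ
  obtain ⟨k, hk⟩ : ∃ k : ℤ, -wt j = k := by
    fin_cases j
    exacts [⟨-1, by simp⟩, ⟨1, by simp⟩]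
  have hκ (l : ℂ) : l - 2 * η * wt j = l + 2 * η * k := by rw [← hk]; ring
  have h1 := LContAt.vcontAt_comp (y₀ := (s, t, l)) (ζ := fun y => y.1) (ω := fun y => y.2.1)
    hs ht (by fun_prop) (by fun_prop) 0 k j j 0 1 hu
  have h2 := LContAt.vcontAt_comp (y₀ := (s, t, l)) (ζ := fun y => y.2.1) (ω := fun y => y.1)
    ht hs (by fun_prop) (by fun_prop) 0 1 0 1 j j hu
  have h3 := LContAt.vcontAt_comp (y₀ := (s, t, l)) (ζ := fun y => y.1) (ω := fun y => y.2.1)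
    hs ht (by fun_prop) (by fun_prop) 0 1 0 1 j j hu
  simp only [Int.cast_zero, mul_zero, add_zero, Int.cast_one, mul_one, ← hκ] at h1 h2 h3
  have hgen : ∀ᶠ y in residual (ℂ × ℂ × ℂ), M.ExchangeRel j μ u y.1 y.2.1 y.2.2 := by
    fin_cases j
    exacts [eventually_exchangeRel_zero hτ hu, eventually_exchangeRel_one hτ hu]
  refine VContAt.eq_of_residual (x := (s, t, l)) (h1.smul ?_) ((h2.smul ?_).add (h3.smul ?_)) hgen
  all_goals unfold dynParam; fun_prop

end EModule

end Commutation

section Operators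

/-- The Kronecker function `θ(ν + y) / (θ(ν) θ(y))`, in terms of which the exchange relations and
their unwanted terms are written. -/
def kronecker (τ ν y : ℂ) : ℂ := theta τ (ν + y) / (theta τ ν * theta τ y)

variable {τ η : ℂ}

lemma kronecker_fay (hτ : 0 < τ.im) {ν x y e : ℂ} (hν : theta τ ν ≠ 0) (hνe : theta τ (ν + e) ≠ 0)
    (hx : theta τ x ≠ 0) (hy : theta τ y ≠ 0) (hxy : theta τ (x - y) ≠ 0) :
    theta τ (x - e) / theta τ x * kronecker τ (ν + e) y +
        theta τ e * kronecker τ ν x * kronecker τ (ν + e) (y - x) =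
      theta τ (x - y - e) / theta τ (x - y) * kronecker τ ν y := by
  have h := theta_three_term hτ ν e x y
  rw [kronecker, kronecker, kronecker, kronecker, show y - x = -(x - y) by ring, theta_neg,
    show ν + e + -(x - y) = ν + e + y - x by ring]
  field_simp
  linear_combination h

namespace EModule

variable {W : Type*} [AddCommGroup W] [Module ℂ W] {M : EModule τ η W}

lemma IsRegular.meroFun_entry {z : ℂ} (hz : M.IsRegular z) {f : ℂ → W} (hf : MeroFun f)
    (i j : Fin 2) : MeroFun (M.entry i j z f) := by
  obtain ⟨k, g, u, hg, h⟩ := hf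
  choose n q v hq hv using fun a => (hz i j (u a)).1
  replace hv : ∀ a x, M.L z x i j (u a) = ∑ b, q a b x • v a b := hv
  refine MeroFun.of_fintype (ι := Σ a, Fin (n a))
    (f := fun b x => g b.1 (x + -(2 * η * wt j)) * q b.1 b.2 x) (u := fun b => v b.1 b.2)
    (fun b x => (meromorphic_comp_add_const (hg b.1) _ x).mul (hq _ _ x)) fun x => ?_
  rw [entry, h, map_sum, Fintype.sum_sigma]
  refine Finset.sum_congr rfl fun a _ => ?_
  rw [map_smul, hv, Finset.smul_sum]
  simp only [mul_smul, sub_eq_add_neg]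

lemma MemFunWeight.entry {z : ℂ} (hz : M.IsRegular z) {μ : ℂ} {f : ℂ → W}
    (hf : M.MemFunWeight μ f) (i j : Fin 2) :
    M.MemFunWeight (μ + wt j - wt i) (M.entry i j z f) :=
  ⟨hz.meroFun_entry hf.1 i j, (eventually_codiscrete_sub_const hf.2 (2 * η * wt j)).mono fun _ hl =>
    M.L_weight _ _ _ _ _ _ hl⟩

lemma MemFunWeight.b {z : ℂ} (hz : M.IsRegular z) {μ : ℂ} {f : ℂ → W}
    (hf : M.MemFunWeight μ f) : M.MemFunWeight (μ - 2) (M.b z f) := by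
  have h := hf.entry hz 0 1
  rwa [wt_one, wt_zero, show μ + -1 - 1 = μ - 2 by ring] at h

lemma MemFunWeight.bProd {μ : ℂ} {f : ℂ → W} (hf : M.MemFunWeight μ f) :
    ∀ l : List ℂ, (∀ z ∈ l, M.IsRegular z) → M.MemFunWeight (μ - 2 * l.length) (M.bProd l f)
  | [], _ => by simpa [EModule.bProd] using hf
  | z :: l, h => by
    have h1 := (hf.bProd l fun y hy => h y (List.mem_cons_of_mem z hy)).b (h z List.mem_cons_self)
    rwa [show μ - 2 * (l.length : ℂ) - 2 = μ - 2 * ((z :: l).length : ℂ) by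
      push_cast [List.length_cons]; ring] at h1

lemma IsRegular.eventually_vcontAt_entry {z : ℂ} (hz : M.IsRegular z) {μ : ℂ} {f : ℂ → W}
    (hf : M.MemFunWeight μ f) (i j : Fin 2) : ∀ᶠ l in codiscrete ℂ,
      VContAt (fun y : ℂ × ℂ => M.entry i j y.1 f y.2) (z, l) := by
  filter_upwards [M.eventually_forall_mem_eigenspace (g := fun l => (z, l)) μ i j
      fun u => (hz i j u).2.mono fun _ h => h.vcontAt,
    eventually_codiscrete_sub_const hf.1.eventually_vcontAt (2 * η * wt j),
    eventually_codiscrete_sub_const (eventually_codiscrete_nhds hf.2) (2 * η * wt j)]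
    with l h1 h2 h3
  have hc : ContinuousAt (fun y : ℂ × ℂ => y.2 - 2 * η * wt j) (z, l) := by fun_prop
  exact VContAt.apply (A := fun y : ℂ × ℂ => M.L y.1 y.2 i j) (U := M.h.eigenspace μ)
    (F := fun y : ℂ × ℂ => f (y.2 - 2 * η * wt j)) (VContAt.comp h2 hc) (hc.eventually h3) h1

variable {μ t : ℂ} {f : ℂ → W}

lemma eventually_b_comm (ht : M.IsRegular t) (hf : M.MemFunWeight μ f) :
    ∀ᶠ x in residual (ℂ × ℂ), M.b t (M.b x.1 f) x.2 = M.b x.1 (M.b t f) x.2 := by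
  have hf' := tendsto_snd_residual_codiscrete.eventually (eventually_codiscrete_sub_const
    (eventually_codiscrete_sub_const hf.2 (2 * η * wt 1)) (2 * η * wt 1))
  filter_upwards [M.eventually_lContAt μ, ht.eventually_lContAt μ, hf'] with x hx hxt hu
  simpa only [EModule.b, EModule.entry, wt_one, mul_neg, mul_one, sub_neg_eq_add] using
    hxt.b_comm hx hu

lemma eventually_entry_b (hτ : 0 < τ.im) (j : Fin 2) (ht : M.IsRegular t)
    (hf : M.MemFunWeight μ f) : ∀ᶠ x in residual (ℂ × ℂ),
      let ν := dynParam η j (μ - 2) x.2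
      M.entry j j x.1 (M.b t f) x.2 = (theta τ ν / theta τ (ν - 2 * η)) •
        ((theta τ (t - x.1 - 2 * η * wt j) / theta τ (t - x.1)) • M.b t (M.entry j j x.1 f) x.2 +
          (theta τ (2 * η * wt j) * kronecker τ ν (t - x.1)) • M.b x.1 (M.entry j j t f) x.2) := by
  have hf' := tendsto_snd_residual_codiscrete.eventually (eventually_codiscrete_sub_const
    (eventually_codiscrete_sub_const hf.2 (2 * η * wt 1)) (2 * η * wt j))
  have hν (a : ℂ) : ∀ᶠ x in residual (ℂ × ℂ), theta τ (dynParam η j (μ - 2) x.2 - a) ≠ 0 := by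
    simp only [dynParam]
    exact tendsto_snd_residual_codiscrete.eventually
      (eventually_codiscrete_sub_const (eventually_theta_sub_ne_zero hτ a) _)
  have hd : ∀ᶠ x in residual (ℂ × ℂ), theta τ (t - x.1) ≠ 0 :=
    tendsto_fst_residual_codiscrete.eventually (eventually_theta_const_sub_ne_zero hτ t)
  filter_upwards [M.eventually_lContAt μ, ht.eventually_lContAt μ, hf', hν 0, hν (2 * η), hd]
    with x hx hxt hu hν0 hν2 hd
  have h := hx.exchangeRel hτ j hxt hu
  rw [sub_zero] at hν0
  simp only [ExchangeRel] at h
  simp only [EModule.b, EModule.entry, kronecker,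
    sub_right_comm x.2 (2 * η * wt 1) (2 * η * wt j)]
  rw [show x.2 - 2 * η * wt 1 = x.2 + 2 * η by rw [wt_one]; ring,
    ← inv_smul_smul₀ (mul_ne_zero hν2 hd) (M.L x.1 x.2 j j _), h]
  match_scalars <;> field_simp

end EModule

end Operators

section Expansion

variable {τ η : ℂ} {ι : Type*}

/-- The factor `∏ θ(t_j - s - κ) / θ(t_j - s)`, `j ∈ S`, picked up by a diagonal entry of `L̃(s)`
moved through the operators `b(t_j)` with both spectral parameters kept in place. -/
def exchangeProd (τ κ : ℂ) (t : ι → ℂ) (S : Finset ι) (s : ℂ) : ℂ :=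
  ∏ j ∈ S, theta τ (t j - s - κ) / theta τ (t j - s)

lemma exchangeProd_insert [DecidableEq ι] {t : ι → ℂ} {i : ι} {S : Finset ι} (hi : i ∉ S)
    (κ s : ℂ) :
    exchangeProd τ κ t (insert i S) s =
      theta τ (t i - s - κ) / theta τ (t i - s) * exchangeProd τ κ t S s :=
  Finset.prod_insert hi

/-- The dependence on `λ` of the coefficients obtained by moving the `j`-th diagonal entry of `L̃`
through `k` operators `b`, if it multiplies the vector of weight `μ` on their right by `φ(λ)`. -/
def dynFactor (τ η : ℂ) (j : Fin 2) (μ : ℂ) (φ : ℂ → ℂ) : ℕ → ℂ → ℂ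
  | 0, l => φ l
  | k + 1, l => theta τ (dynParam η j (μ - 2 * (k + 1)) l) /
      theta τ (dynParam η j (μ - 2 * (k + 1)) l - 2 * η) * dynFactor τ η j μ φ k (l + 2 * η)

lemma dynParam_add (j : Fin 2) (μ l : ℂ) :
    dynParam η j μ (l + 2 * η) = dynParam η j (μ - 2) l + 2 * η * wt j := by
  fin_cases j
  · simp [dynParam]
  · simp [dynParam]
    ring

lemma continuous_dynParam (j : Fin 2) (μ : ℂ) : Continuous (dynParam η j μ) := by
  unfold dynParam
  fun_prop

lemma tendsto_dynParam_codiscrete (j : Fin 2) (μ : ℂ) :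
    Tendsto (dynParam η j μ) (codiscrete ℂ) (codiscrete ℂ) := by
  unfold dynParam
  simpa only [sub_eq_add_neg] using
    tendsto_add_const_codiscrete (-(2 * η * (if j = 0 then 0 else μ)))

lemma meromorphic_dynFactor (hτ : 0 < τ.im) (j : Fin 2) (μ : ℂ) {φ : ℂ → ℂ} (hφ : Meromorphic φ) :
    ∀ k, Meromorphic (dynFactor τ η j μ φ k)
  | 0 => hφ
  | k + 1 => fun l => by
    have hd : Differentiable ℂ fun l => dynParam η j (μ - 2 * (k + 1)) l := by
      unfold dynParam
      fun_prop
    have hθ := differentiable_theta hτ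
    exact (((hθ.comp hd).analyticAt l).meromorphicAt.div
      ((hθ.comp (hd.sub_const (2 * η))).analyticAt l).meromorphicAt).mul
      (meromorphic_comp_add_const (meromorphic_dynFactor hτ j μ hφ k) (2 * η) l)

lemma continuousAt_kronecker (hτ : 0 < τ.im) {X : Type*} [TopologicalSpace X] {ν y : X → ℂ} {x : X}
    (hν : ContinuousAt ν x) (hy : ContinuousAt y x) (hν0 : theta τ (ν x) ≠ 0)
    (hy0 : theta τ (y x) ≠ 0) : ContinuousAt (fun x => kronecker τ (ν x) (y x)) x := by
  have hθ {g : X → ℂ} (hg : ContinuousAt g x) : ContinuousAt (fun x => theta τ (g x)) x :=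
    (continuous_theta hτ).continuousAt.comp hg
  exact (hθ (hν.add hy)).div ((hθ hν).mul (hθ hy)) (mul_ne_zero hν0 hy0)

lemma differentiableAt_exchangeProd (hτ : 0 < τ.im) (κ : ℂ) {t : ι → ℂ} {S : Finset ι} {s : ℂ}
    (h : ∀ j ∈ S, theta τ (t j - s) ≠ 0) : DifferentiableAt ℂ (exchangeProd τ κ t S) s := by
  have hθ := differentiable_theta hτ
  exact DifferentiableAt.fun_finsetProd fun j hj => DifferentiableAt.fun_div
    (hθ.comp (g := theta τ) (by fun_prop : Differentiable ℂ fun s => t j - s - κ) s)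
    (hθ.comp (g := theta τ) (by fun_prop : Differentiable ℂ fun s => t j - s) s) (h j hj)

namespace EModule

variable {W : Type*} [AddCommGroup W] [Module ℂ W] (M : EModule τ η W) [LinearOrder ι]

/-- The Bethe vector `∏ b(t_i) v`, `i ∈ S`, with the factors in increasing order of `i`. -/
def betheVec (t : ι → ℂ) (v : ℂ → W) (S : Finset ι) : ℂ → W :=
  M.bProd ((S.sort (· ≤ ·)).map t) v

/-- The Bethe vector on `S` with the first `b(t_i)` replaced by `b(s)`, as it occurs in the
unwanted terms. -/
def unwantedVec (t : ι → ℂ) (v : ℂ → W) (S : Finset ι) (i : ι) (s : ℂ) : ℂ → W :=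
  M.b s (M.betheVec t v (S.erase i))

/-- The expansion of the `j`-th diagonal entry of `L̃(s)` on a Bethe vector: the wanted term and the
unwanted terms, for a vector `v` of weight `μ` on which this entry acts by `φ(λ) ε(s)`. -/
def betheExpansion (j : Fin 2) (μ : ℂ) (φ ε : ℂ → ℂ) (t : ι → ℂ) (v : ℂ → W) (S : Finset ι)
    (x : ℂ × ℂ) : W :=
  dynFactor τ η j μ φ S.card x.2 •
    ((ε x.1 * exchangeProd τ (2 * η * wt j) t S x.1) • M.betheVec t v S x.2 +
      ∑ i ∈ S, (ε (t i) * exchangeProd τ (2 * η * wt j) t (S.erase i) (t i) *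
        (theta τ (2 * η * wt j) * kronecker τ (dynParam η j (μ - 2 * S.card) x.2) (t i - x.1))) •
          M.unwantedVec t v S i x.1 x.2)

variable {M} {t : ι → ℂ} {v : ℂ → W} {μ : ℂ}

lemma betheVec_empty : M.betheVec t v ∅ = v := by
  simp [betheVec, EModule.bProd]

lemma betheVec_insert {S : Finset ι} {i : ι} (hi : ∀ j ∈ S, i < j) :
    M.betheVec t v (insert i S) = M.b (t i) (M.betheVec t v S) := by
  rw [betheVec, Finset.sort_insert _ (fun j hj => (hi j hj).le) fun h => (hi i h).false]
  rfl

lemma memFunWeight_betheVec (ht : ∀ i, M.IsRegular (t i)) (hv : M.MemFunWeight μ v)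
    (S : Finset ι) : M.MemFunWeight (μ - 2 * S.card) (M.betheVec t v S) := by
  have h := hv.bProd ((S.sort (· ≤ ·)).map t) fun y hy => by
    obtain ⟨i, -, rfl⟩ := List.mem_map.1 hy
    exact ht i
  rwa [List.length_map, Finset.length_sort] at h

lemma eventually_vcontAt_betheExpansion (hτ : 0 < τ.im) (j : Fin 2) {φ ε : ℂ → ℂ}
    (hφ : Meromorphic φ) (ht : ∀ i, M.IsRegular (t i)) (hv : M.MemFunWeight μ v) {S : Finset ι}
    {s : ℂ} (hs : M.IsRegular s) (hε : ContinuousAt ε s) (hne : ∀ i ∈ S, theta τ (t i - s) ≠ 0) :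
    ∀ᶠ l in codiscrete ℂ, VContAt (M.betheExpansion j μ φ ε t v S) (s, l) := by
  have hu : ∀ᶠ l in codiscrete ℂ, ∀ i ∈ S,
      VContAt (fun x : ℂ × ℂ => M.unwantedVec t v S i x.1 x.2) (s, l) :=
    (Finset.eventually_all S).2 fun i _ =>
      hs.eventually_vcontAt_entry (memFunWeight_betheVec ht hv (S.erase i)) 0 1
  filter_upwards [eventually_continuousAt_of_meromorphic
      (meromorphic_dynFactor (η := η) hτ j μ hφ S.card),
    (memFunWeight_betheVec ht hv S).1.eventually_vcontAt_snd s, hu,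
    (tendsto_dynParam_codiscrete (η := η) j (μ - 2 * S.card)).eventually
      (eventually_theta_ne_zero hτ)] with l h1 h2 h3 h4
  refine VContAt.smul (ContinuousAt.comp (x := (s, l)) (f := Prod.snd) h1 continuousAt_snd)
    ((h2.smul ?_).add (VContAt.sum S fun i hi => (h3 i hi).smul ?_))
  · exact ContinuousAt.comp (x := (s, l)) (f := Prod.fst)
      (hε.mul (differentiableAt_exchangeProd hτ _ hne).continuousAt) continuousAt_fst
  · exact continuousAt_const.mul (continuousAt_const.mul (continuousAt_kronecker hτ
      ((continuous_dynParam j _).continuousAt.comp continuousAt_snd) (by fun_prop) h4 (hne i hi)))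

variable {j : Fin 2} {φ ε : ℂ → ℂ}

lemma b_entry_betheVec {S : Finset ι} {s u l : ℂ}
    (h : M.entry j j u (M.betheVec t v S) (l + 2 * η) =
      M.betheExpansion j μ φ ε t v S (u, l + 2 * η)) :
    M.b s (M.entry j j u (M.betheVec t v S)) l = dynFactor τ η j μ φ S.card (l + 2 * η) •
      ((ε u * exchangeProd τ (2 * η * wt j) t S u) • M.b s (M.betheVec t v S) l +
        ∑ i ∈ S, (ε (t i) * exchangeProd τ (2 * η * wt j) t (S.erase i) (t i) *
          (theta τ (2 * η * wt j) *
            kronecker τ (dynParam η j (μ - 2 * (S.card + 1)) l + 2 * η * wt j) (t i - u))) •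
          M.b s (M.unwantedVec t v S i u) l) := by
  have hl : l - 2 * η * wt 1 = l + 2 * η := by rw [wt_one]; ring
  have hν : dynParam η j (μ - 2 * S.card) (l + 2 * η) =
      dynParam η j (μ - 2 * (S.card + 1)) l + 2 * η * wt j := by
    rw [dynParam_add, show μ - 2 * (S.card : ℂ) - 2 = μ - 2 * (S.card + 1) by ring]
  simp only [EModule.b, EModule.entry] at h ⊢
  simp only [hl, h, betheExpansion, hν, map_smul, map_add, map_sum]

lemma b_unwantedVec {S : Finset ι} {i k : ι} (hi : ∀ j ∈ S, i < j) (hk : k ∈ S) (s : ℂ) :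
    M.b s (M.unwantedVec t v S k (t i)) = M.unwantedVec t v (insert i S) k s := by
  rw [unwantedVec, unwantedVec, Finset.erase_insert_of_ne (hi k hk).ne, betheVec_insert]
  exact fun j hj => hi j (Finset.mem_of_mem_erase hj)

lemma eventually_b_unwantedVec (ht : ∀ i, M.IsRegular (t i)) (hv : M.MemFunWeight μ v)
    {S : Finset ι} {i : ι} (hi : ∀ j ∈ S, i < j) : ∀ᶠ x in residual (ℂ × ℂ), ∀ k ∈ S,
      M.b (t i) (M.unwantedVec t v S k x.1) x.2 = M.unwantedVec t v (insert i S) k x.1 x.2 := by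
  refine (Finset.eventually_all S).2 fun k hk => ?_
  filter_upwards [eventually_b_comm (ht i) (memFunWeight_betheVec ht hv (S.erase k))] with x hx
  rw [unwantedVec, hx, ← b_unwantedVec hi hk, unwantedVec]

lemma entry_betheVec_eq_of_residual (hτ : 0 < τ.im) (hφ : Meromorphic φ)
    (ht : ∀ i, M.IsRegular (t i)) (hv : M.MemFunWeight μ v) {S : Finset ι} {s : ℂ}
    (hs : M.IsRegular s) (hε : ContinuousAt ε s) (hne : ∀ i ∈ S, theta τ (t i - s) ≠ 0)
    (h : ∀ᶠ x in residual (ℂ × ℂ),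
      M.entry j j x.1 (M.betheVec t v S) x.2 = M.betheExpansion j μ φ ε t v S x) :
    ∀ᶠ l in codiscrete ℂ,
      M.entry j j s (M.betheVec t v S) l = M.betheExpansion j μ φ ε t v S (s, l) := by
  filter_upwards [hs.eventually_vcontAt_entry (memFunWeight_betheVec ht hv S) j j,
    eventually_vcontAt_betheExpansion hτ j hφ ht hv hs hε hne] with l h1 h2
  exact h1.eq_of_residual h2 h

lemma sum_unwantedVec_insert (hτ : 0 < τ.im) {S : Finset ι} {i : ι} (hi : i ∉ S) {w l : ℂ}
    (hw : ∀ k ∈ insert i S, theta τ (t k - w) ≠ 0) (hne : ∀ k ∈ S, theta τ (t i - t k) ≠ 0)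
    {κ ν : ℂ} (hν : theta τ ν ≠ 0) (hνκ : theta τ (ν + κ) ≠ 0) :
    ∑ k ∈ S, (ε (t k) * exchangeProd τ κ t ((insert i S).erase k) (t k) *
        (theta τ κ * kronecker τ ν (t k - w))) • M.unwantedVec t v (insert i S) k w l =
      (theta τ (t i - w - κ) / theta τ (t i - w)) •
        ∑ k ∈ S, (ε (t k) * exchangeProd τ κ t (S.erase k) (t k) *
          (theta τ κ * kronecker τ (ν + κ) (t k - w))) • M.unwantedVec t v (insert i S) k w l +
      (theta τ κ * kronecker τ ν (t i - w)) •
        ∑ k ∈ S, (ε (t k) * exchangeProd τ κ t (S.erase k) (t k) *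
          (theta τ κ * kronecker τ (ν + κ) (t k - t i))) •
            M.unwantedVec t v (insert i S) k w l := by
  rw [Finset.smul_sum, Finset.smul_sum, ← Finset.sum_add_distrib]
  refine Finset.sum_congr rfl fun k hk => ?_
  have hfay := kronecker_fay hτ hν hνκ (hw i (Finset.mem_insert_self i S))
    (hw k (Finset.mem_insert_of_mem hk)) (by simpa only [sub_sub_sub_cancel_right] using hne k hk)
  rw [sub_sub_sub_cancel_right, sub_sub_sub_cancel_right] at hfay
  rw [Finset.erase_insert_of_ne (by rintro rfl; exact hi hk),
    exchangeProd_insert fun h => hi (Finset.mem_of_mem_erase h), smul_smul, smul_smul, ← add_smul]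
  congr 1
  linear_combination (-ε (t k) * exchangeProd τ κ t (S.erase k) (t k) * theta τ κ) * hfay

lemma betheExpansion_insert (hτ : 0 < τ.im) {S : Finset ι} {i : ι} (hi : i ∉ S) {w l : ℂ}
    (hw : ∀ k ∈ insert i S, theta τ (t k - w) ≠ 0) (hne : ∀ k ∈ S, theta τ (t i - t k) ≠ 0)
    {ν : ℂ} (hν : ν = dynParam η j (μ - 2 * (S.card + 1)) l) (hν0 : theta τ ν ≠ 0)
    (hνκ : theta τ (ν + 2 * η * wt j) ≠ 0) :
    M.betheExpansion j μ φ ε t v (insert i S) (w, l) =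
      (theta τ ν / theta τ (ν - 2 * η) * dynFactor τ η j μ φ S.card (l + 2 * η)) •
      ((theta τ (t i - w - 2 * η * wt j) / theta τ (t i - w)) •
        ((ε w * exchangeProd τ (2 * η * wt j) t S w) • M.betheVec t v (insert i S) l +
          ∑ k ∈ S, (ε (t k) * exchangeProd τ (2 * η * wt j) t (S.erase k) (t k) *
            (theta τ (2 * η * wt j) * kronecker τ (ν + 2 * η * wt j) (t k - w))) •
              M.unwantedVec t v (insert i S) k w l) +
        (theta τ (2 * η * wt j) * kronecker τ ν (t i - w)) •
        ((ε (t i) * exchangeProd τ (2 * η * wt j) t S (t i)) •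
          M.unwantedVec t v (insert i S) i w l +
          ∑ k ∈ S, (ε (t k) * exchangeProd τ (2 * η * wt j) t (S.erase k) (t k) *
            (theta τ (2 * η * wt j) * kronecker τ (ν + 2 * η * wt j) (t k - t i))) •
              M.unwantedVec t v (insert i S) k w l)) := by
  rw [betheExpansion, Finset.card_insert_of_notMem hi, Finset.sum_insert hi,
    Finset.erase_insert hi, exchangeProd_insert hi]
  push_cast
  simp only [← hν, sum_unwantedVec_insert hτ hi hw hne hν0 hνκ, dynFactor]
  module

/-- The Bethe ansatz computation: the exchange relation moves `L̃` through the `b(t_i)` one at a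
time, and the addition theorem collects the two contributions to each unwanted term. -/
theorem eventually_entry_betheVec (hτ : 0 < τ.im) (hφ : Meromorphic φ)
    (hε : ∀ i, ContinuousAt ε (t i)) (ht : ∀ i, M.IsRegular (t i))
    (hne : Pairwise fun i k => theta τ (t i - t k) ≠ 0) (hv : M.MemFunWeight μ v)
    (h : ∀ᶠ x in residual (ℂ × ℂ), M.entry j j x.1 v x.2 = (φ x.2 * ε x.1) • v x.2)
    (S : Finset ι) : ∀ᶠ x in residual (ℂ × ℂ),
      M.entry j j x.1 (M.betheVec t v S) x.2 = M.betheExpansion j μ φ ε t v S x := by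
  induction S using Finset.induction_on_min with
  | empty =>
    filter_upwards [h] with x hx
    simpa [betheVec_empty, betheExpansion, exchangeProd, dynFactor, mul_smul] using hx
  | insert i S hi ih =>
    have hiS : i ∉ S := fun h => (hi i h).false
    have hti : ∀ᶠ x in residual (ℂ × ℂ), M.entry j j (t i) (M.betheVec t v S) (x.2 + 2 * η) =
        M.betheExpansion j μ φ ε t v S (t i, x.2 + 2 * η) :=
      tendsto_snd_residual_codiscrete.eventually ((tendsto_add_const_codiscrete _).eventually
        (entry_betheVec_eq_of_residual hτ hφ ht hv (ht i) (hε i)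
          (fun k hk => hne (hi k hk).ne') ih))
    have hw : ∀ᶠ x in residual (ℂ × ℂ), ∀ k ∈ insert i S, theta τ (t k - x.1) ≠ 0 :=
      (Finset.eventually_all _).2 fun k _ => tendsto_fst_residual_codiscrete.eventually
        (eventually_theta_const_sub_ne_zero hτ (t k))
    have hν : ∀ᶠ l in codiscrete ℂ, theta τ (dynParam η j (μ - 2 * (S.card + 1)) l) ≠ 0 ∧
        theta τ (dynParam η j (μ - 2 * (S.card + 1)) l + 2 * η * wt j) ≠ 0 :=
      (tendsto_dynParam_codiscrete j _).eventually ((eventually_theta_ne_zero hτ).and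
        ((tendsto_add_const_codiscrete _).eventually (eventually_theta_ne_zero hτ)))
    filter_upwards [eventually_entry_b hτ j (ht i) (memFunWeight_betheVec ht hv S),
      (tendsto_snd_add_residual (2 * η)).eventually ih, hti, hw,
      tendsto_snd_residual_codiscrete.eventually hν, eventually_b_unwantedVec ht hv hi]
      with x hb hx hxi hw hν hu
    have hμ : μ - 2 * (S.card : ℂ) - 2 = μ - 2 * (S.card + 1) := by ring
    simp only [hμ] at hb
    have hA := b_entry_betheVec (s := t i) hx
    have hB := b_entry_betheVec (s := x.1) hxi
    rw [Finset.sum_congr rfl fun k hk => by rw [hu k hk]] at hA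
    rw [Finset.sum_congr rfl fun k hk => by rw [b_unwantedVec hi hk]] at hB
    rw [betheVec_insert hi, hb, hA, hB,
      betheExpansion_insert hτ hiS hw (fun k hk => hne (hi k hk).ne) rfl hν.1 hν.2,
      unwantedVec, Finset.erase_insert hiS, betheVec_insert hi]
    module

end EModule

end Expansion

section ReferenceVector

variable {τ η c : ℂ}

/-- The scalar function `e^{cλ} ∏ θ(λ - 2ηj)` by which `vFun` multiplies the highest weight
vector. -/
def vCoeff (τ η c : ℂ) (m : ℕ) (l : ℂ) : ℂ :=
  exp (c * l) * ∏ j ∈ Finset.Icc 1 m, theta τ (l - 2 * η * (j : ℂ))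

lemma differentiable_vCoeff (hτ : 0 < τ.im) (m : ℕ) : Differentiable ℂ (vCoeff τ η c m) := by
  have hθ := differentiable_theta hτ
  exact Differentiable.mul (by fun_prop) (Differentiable.fun_finsetProd fun j _ =>
    hθ.comp (by fun_prop : Differentiable ℂ fun l : ℂ => l - 2 * η * (j : ℂ)))

lemma theta_mul_prod_theta_sub (m : ℕ) (l : ℂ) :
    theta τ (l - 2 * η) * ∏ j ∈ Finset.Icc 1 m, theta τ (l - 2 * η - 2 * η * (j : ℂ)) =
      theta τ (l - 2 * η * (m + 1)) * ∏ j ∈ Finset.Icc 1 m, theta τ (l - 2 * η * (j : ℂ)) := by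
  induction m with
  | zero => simp
  | succ m ih =>
    rw [Finset.prod_Icc_succ_top (by omega), Finset.prod_Icc_succ_top (by omega), ← mul_assoc, ih]
    push_cast
    rw [show l - 2 * η - 2 * η * ((m : ℂ) + 1) = l - 2 * η * (m + 1 + 1) by ring]
    ring

lemma vCoeff_sub (m : ℕ) {l : ℂ} (h : theta τ (l - 2 * η) ≠ 0) :
    vCoeff τ η c m (l - 2 * η) = exp (-2 * η * c) *
      (theta τ (l - 2 * η * (m + 1)) / theta τ (l - 2 * η)) * vCoeff τ η c m l := by
  rw [vCoeff, vCoeff, show c * (l - 2 * η) = -2 * η * c + c * l by ring, exp_add]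
  field_simp
  linear_combination theta_mul_prod_theta_sub m l

lemma vCoeff_add (m : ℕ) {l : ℂ} (h : theta τ (l - 2 * η * m) ≠ 0) :
    vCoeff τ η c m (l + 2 * η) = exp (2 * η * c) *
      (theta τ l / theta τ (l - 2 * η * m)) * vCoeff τ η c m l := by
  have h1 := theta_mul_prod_theta_sub (τ := τ) (η := η) m (l + 2 * η)
  rw [show l + 2 * η - 2 * η = l by ring,
    show l + 2 * η - 2 * η * ((m : ℂ) + 1) = l - 2 * η * m by ring] at h1
  rw [vCoeff, vCoeff, show c * (l + 2 * η) = 2 * η * c + c * l by ring, exp_add]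
  field_simp
  linear_combination -h1

/-- The quotient `θ(λ - a) / θ(λ - b)`; the functions `φ` and the factors `dynFactor` of the Bethe
vector are multiples of such quotients. -/
def thetaQuot (τ a b l : ℂ) : ℂ := theta τ (l - a) / theta τ (l - b)

lemma differentiable_theta_sub (hτ : 0 < τ.im) (a : ℂ) :
    Differentiable ℂ fun l => theta τ (l - a) :=
  (differentiable_theta hτ).comp (by fun_prop : Differentiable ℂ fun l => l - a)

lemma meromorphic_thetaQuot (hτ : 0 < τ.im) (a b : ℂ) : Meromorphic (thetaQuot τ a b) := fun l =>
  ((differentiable_theta_sub hτ a).analyticAt l).meromorphicAt.div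
    ((differentiable_theta_sub hτ b).analyticAt l).meromorphicAt

lemma eventually_dynFactor_zero (hτ : 0 < τ.im) (μ C a : ℂ) : ∀ k : ℕ, ∀ᶠ l in codiscrete ℂ,
    dynFactor τ η 0 μ (fun l => C * thetaQuot τ a (2 * η) l) k l =
      C * thetaQuot τ (a - 2 * η * k) (2 * η) l
  | 0 => by simp [dynFactor]
  | k + 1 => by
    filter_upwards [(tendsto_add_const_codiscrete (2 * η)).eventually
      (eventually_dynFactor_zero hτ μ C a k), eventually_theta_ne_zero hτ] with l hl h0
    rw [dynFactor, hl, thetaQuot, thetaQuot, add_sub_cancel_right,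
      show dynParam η 0 (μ - 2 * (k + 1)) l = l by simp [dynParam]]
    push_cast
    rw [show l + 2 * η - (a - 2 * η * k) = l - (a - 2 * η * (k + 1)) by ring]
    field_simp

lemma eventually_dynFactor_one (hτ : 0 < τ.im) (μ C b : ℂ) : ∀ k : ℕ, ∀ᶠ l in codiscrete ℂ,
    dynFactor τ η 1 μ (fun l => C * thetaQuot τ (2 * η * μ) b l) k l =
      C * thetaQuot τ (2 * η * (μ - 2 * k)) (b - 2 * η * k) l
  | 0 => by simp [dynFactor]
  | k + 1 => by
    filter_upwards [(tendsto_add_const_codiscrete (2 * η)).eventually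
      (eventually_dynFactor_one hτ μ C b k),
      eventually_theta_sub_ne_zero hτ (2 * η * (μ - 2 * (k + 1) + 1))] with l hl h0
    rw [dynFactor, hl, thetaQuot, thetaQuot,
      show dynParam η 1 (μ - 2 * (k + 1)) l = l - 2 * η * (μ - 2 * (k + 1)) by simp [dynParam]]
    push_cast
    rw [show l + 2 * η - 2 * η * (μ - 2 * k) = l - 2 * η * (μ - 2 * (k + 1) + 1) by ring,
      show l + 2 * η - (b - 2 * η * k) = l - (b - 2 * η * (k + 1)) by ring,
      show l - 2 * η * (μ - 2 * (k + 1)) - 2 * η = l - 2 * η * (μ - 2 * (k + 1) + 1) by ring]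
    field_simp

namespace EModule

variable {W : Type*} [AddCommGroup W] [Module ℂ W] {M : EModule τ η W} {v₀ : ℂ → W} {m : ℕ}

lemma memFunWeight_vFun (hτ : 0 < τ.im) {μ : ℂ} (hv : M.MemFunWeight μ v₀) :
    M.MemFunWeight μ (vFun τ η c m v₀) :=
  ⟨hv.1.smul fun l => ((differentiable_vCoeff hτ m).analyticAt l).meromorphicAt,
    hv.2.mono fun _ h => Submodule.smul_mem _ _ h⟩

lemma eventually_entry_vFun {j : Fin 2} {φ₀ φ ε : ℂ → ℂ}
    (h : ∀ᶠ x in residual (ℂ × ℂ), M.entry j j x.1 v₀ x.2 = (φ₀ x.2 * ε x.1) • v₀ x.2)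
    (hφ : ∀ᶠ l in codiscrete ℂ,
      vCoeff τ η c m (l - 2 * η * wt j) * φ₀ l = φ l * vCoeff τ η c m l) :
    ∀ᶠ x in residual (ℂ × ℂ),
      M.entry j j x.1 (vFun τ η c m v₀) x.2 = (φ x.2 * ε x.1) • vFun τ η c m v₀ x.2 := by
  filter_upwards [h, tendsto_snd_residual_codiscrete.eventually hφ] with x hx hφx
  calc M.entry j j x.1 (vFun τ η c m v₀) x.2
      = vCoeff τ η c m (x.2 - 2 * η * wt j) • M.entry j j x.1 v₀ x.2 := map_smul _ _ _
    _ = (φ x.2 * ε x.1) • vCoeff τ η c m x.2 • v₀ x.2 := by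
      rw [hx, smul_smul, smul_smul]
      congr 1
      linear_combination ε x.1 * hφx

lemma eventually_a_vFun (hτ : 0 < τ.im)
    (h : ∀ᶠ x in residual (ℂ × ℂ), M.a x.1 v₀ x.2 = v₀ x.2) : ∀ᶠ x in residual (ℂ × ℂ),
      M.entry 0 0 x.1 (vFun τ η c m v₀) x.2 =
        (exp (-2 * η * c) * thetaQuot τ (2 * η * (m + 1)) (2 * η) x.2 * 1) •
          vFun τ η c m v₀ x.2 := by
  refine eventually_entry_vFun (φ₀ := fun _ => 1) (ε := fun _ => 1)
    (φ := fun l => exp (-2 * η * c) * thetaQuot τ (2 * η * (m + 1)) (2 * η) l)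
    (by simpa [EModule.a] using h) ?_
  filter_upwards [eventually_theta_sub_ne_zero hτ (2 * η)] with l hl
  rw [wt_zero, mul_one, mul_one, vCoeff_sub m hl, thetaQuot]

lemma eventually_d_vFun (hτ : 0 < τ.im) {ε : ℂ → ℂ} (h : ∀ᶠ x in residual (ℂ × ℂ),
      M.d x.1 v₀ x.2 = (thetaQuot τ (2 * η * (2 * m)) 0 x.2 * ε x.1) • v₀ x.2) :
    ∀ᶠ x in residual (ℂ × ℂ), M.entry 1 1 x.1 (vFun τ η c m v₀) x.2 =
      (exp (2 * η * c) * thetaQuot τ (2 * η * (2 * m)) (2 * η * m) x.2 * ε x.1) •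
        vFun τ η c m v₀ x.2 := by
  refine eventually_entry_vFun (ε := ε)
    (φ := fun l => exp (2 * η * c) * thetaQuot τ (2 * η * (2 * m)) (2 * η * m) l) h ?_
  filter_upwards [eventually_theta_ne_zero hτ, eventually_theta_sub_ne_zero hτ (2 * η * m)]
    with l h0 hl
  rw [wt_one, mul_neg_one, sub_neg_eq_add, vCoeff_add m hl, thetaQuot, thetaQuot, sub_zero]
  field_simp

end EModule

end ReferenceVector

section Eigenvalue

variable {τ η c : ℂ} {n m : ℕ} {p q : Fin n → ℂ} {t : Fin m → ℂ}

/-- The factor `∏ θ(w - p_k) / θ(w - q_k)` of `Dfun` that depends on the spectral parameter. -/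
def spectralProd (τ : ℂ) (p q : Fin n → ℂ) (w : ℂ) : ℂ :=
  ∏ k, theta τ (w - p k) / theta τ (w - q k)

lemma eigval_eq_exchangeProd (w : ℂ) : eigval τ η c p q t w =
    exp (-2 * η * c) * exchangeProd τ (2 * η) t Finset.univ w +
      exp (2 * η * c) * exchangeProd τ (-(2 * η)) t Finset.univ w * spectralProd τ p q w := by
  simp only [eigval, exchangeProd, spectralProd, sub_neg_eq_add]

lemma differentiableAt_spectralProd (hτ : 0 < τ.im) {w : ℂ} (h : ∀ k, theta τ (w - q k) ≠ 0) :
    DifferentiableAt ℂ (spectralProd τ p q) w :=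
  DifferentiableAt.fun_finsetProd fun k _ =>
    (differentiable_theta_sub hτ (p k) w).fun_div (differentiable_theta_sub hτ (q k) w) (h k)

lemma theta_sub_ne_zero_of_distinct (hτ : 0 < τ.im)
    (ht : ∀ i j, i < j → ∀ r s : ℤ, t i - t j ≠ r + s * τ) :
    Pairwise fun i j => theta τ (t i - t j) ≠ 0 := by
  have hlt {i j : Fin m} (hij : i < j) : theta τ (t i - t j) ≠ 0 := fun h => by
    obtain ⟨r, s, hrs⟩ := mem_lattice_of_theta_eq_zero hτ h
    exact ht i j hij r s hrs
  intro i j hij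
  rcases lt_or_gt_of_ne hij with h | h
  · exact hlt h
  · rw [← neg_sub, theta_neg, neg_ne_zero]
    exact hlt h

lemma BetheEqs.theta_sub_ne_zero (h : BetheEqs τ η c p q t) (i : Fin m) (k : Fin n) :
    theta τ (t i - q k) ≠ 0 := by
  intro h0
  have hi := h.2.2 i
  rw [Finset.prod_eq_zero (s := Finset.univ) (Finset.mem_univ k) (by rw [h0, zero_div]),
    mul_zero] at hi
  exact exp_ne_zero _ hi.symm

lemma BetheEqs.exchangeProd_eq (h : BetheEqs τ η c p q t) (i : Fin m) :
    exp (-2 * η * c) * exchangeProd τ (2 * η) t (Finset.univ.erase i) (t i) =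
      exp (2 * η * c) * exchangeProd τ (-(2 * η)) t (Finset.univ.erase i) (t i) *
        spectralProd τ p q (t i) := by
  have hi := h.2.2 i
  have hB : ∏ j ∈ Finset.univ.erase i, theta τ (t j - t i + 2 * η) ≠ 0 :=
    Finset.prod_ne_zero_iff.2 fun j hj => h.1 i j (Finset.ne_of_mem_erase hj)
  have hP : ∏ k, theta τ (t i - p k) ≠ 0 := Finset.prod_ne_zero_iff.2 fun k _ => h.2.1 i k
  have hQ : ∏ k, theta τ (t i - q k) ≠ 0 :=
    Finset.prod_ne_zero_iff.2 fun k _ => h.theta_sub_ne_zero i k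
  rw [show exp (2 * η * c) = exp (-2 * η * c) * exp (4 * η * c) by rw [← exp_add]; ring_nf, ← hi]
  simp only [exchangeProd, spectralProd, Finset.prod_div_distrib, sub_neg_eq_add]
  field_simp

namespace EModule

variable {W : Type*} [AddCommGroup W] [Module ℂ W] {M : EModule τ η W} {v v₀ : ℂ → W}

/-- The Bethe equations cancel the unwanted terms in pairs. -/
lemma betheExpansion_add_betheExpansion (h : BetheEqs τ η c p q t) {φ₀ φ₁ : ℂ → ℂ} {l : ℂ}
    (h₀ : dynFactor τ η 0 (2 * m) φ₀ m l = exp (-2 * η * c))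
    (h₁ : dynFactor τ η 1 (2 * m) φ₁ m l = exp (2 * η * c)) (w : ℂ) :
    M.betheExpansion 0 (2 * m) φ₀ (fun _ => 1) t v Finset.univ (w, l) +
      M.betheExpansion 1 (2 * m) φ₁ (spectralProd τ p q) t v Finset.univ (w, l) =
        eigval τ η c p q t w • M.betheVec t v Finset.univ l := by
  have hdyn (j : Fin 2) : dynParam η j (2 * m - 2 * m) l = l := by simp [dynParam]
  have hcancel : exp (-2 * η * c) • ∑ i, (1 *
        exchangeProd τ (2 * η) t (Finset.univ.erase i) (t i) *
          (theta τ (2 * η) * kronecker τ l (t i - w))) • M.unwantedVec t v Finset.univ i w l +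
      exp (2 * η * c) • ∑ i, (spectralProd τ p q (t i) *
        exchangeProd τ (-(2 * η)) t (Finset.univ.erase i) (t i) *
          (theta τ (-(2 * η)) * kronecker τ l (t i - w))) •
            M.unwantedVec t v Finset.univ i w l = 0 := by
    rw [Finset.smul_sum, Finset.smul_sum, ← Finset.sum_add_distrib]
    refine Finset.sum_eq_zero fun i _ => ?_
    rw [theta_neg, smul_smul, smul_smul, ← add_smul]
    convert zero_smul ℂ _
    linear_combination theta τ (2 * η) * kronecker τ l (t i - w) * h.exchangeProd_eq i
  simp only [betheExpansion, Finset.card_univ, Fintype.card_fin, h₀, h₁, wt_zero, wt_one, mul_one,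
    mul_neg_one, hdyn]
  rw [eigval_eq_exchangeProd, smul_add, smul_add, add_add_add_comm, hcancel]
  module

lemma eventually_T_betheVec (hτ : 0 < τ.im) (ht : ∀ i, M.IsRegular (t i))
    (hne : Pairwise fun i j => theta τ (t i - t j) ≠ 0) (h : BetheEqs τ η c p q t)
    (hv : M.MemFunWeight (2 * m) v₀) (ha : ∀ᶠ x in residual (ℂ × ℂ), M.a x.1 v₀ x.2 = v₀ x.2)
    (hd : ∀ᶠ x in residual (ℂ × ℂ),
      M.d x.1 v₀ x.2 = Dfun τ η (2 * m) p q x.1 x.2 • v₀ x.2) :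
    ∀ᶠ x in residual (ℂ × ℂ), M.T x.1 (M.betheVec t (vFun τ η c m v₀) Finset.univ) x.2 =
      eigval τ η c p q t x.1 • M.betheVec t (vFun τ η c m v₀) Finset.univ x.2 := by
  have hmero (C a b : ℂ) : Meromorphic fun l => C * thetaQuot τ a b l := fun l =>
    (MeromorphicAt.const C l).mul (meromorphic_thetaQuot hτ a b l)
  have hspec (i : Fin m) : ContinuousAt (spectralProd τ p q) (t i) :=
    (differentiableAt_spectralProd hτ (h.theta_sub_ne_zero i)).continuousAt
  have hv' := memFunWeight_vFun (c := c) (m := m) hτ hv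
  have h₀ : ∀ᶠ l in codiscrete ℂ, dynFactor τ η 0 (2 * m)
      (fun l => exp (-2 * η * c) * thetaQuot τ (2 * η * (m + 1)) (2 * η) l) m l =
        exp (-2 * η * c) := by
    filter_upwards [eventually_dynFactor_zero hτ (2 * m) (exp (-2 * η * c)) (2 * η * (m + 1)) m,
      eventually_theta_sub_ne_zero hτ (2 * η)] with l hl hne
    rw [hl, thetaQuot, show 2 * η * (m + 1) - 2 * η * m = 2 * η by ring, div_self hne, mul_one]
  have h₁ : ∀ᶠ l in codiscrete ℂ, dynFactor τ η 1 (2 * m)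
      (fun l => exp (2 * η * c) * thetaQuot τ (2 * η * (2 * m)) (2 * η * m) l) m l =
        exp (2 * η * c) := by
    filter_upwards [eventually_dynFactor_one hτ (2 * m) (exp (2 * η * c)) (2 * η * m) m,
      eventually_theta_ne_zero hτ] with l hl hne
    rw [hl, thetaQuot, sub_self, sub_self, mul_zero, sub_zero, div_self hne, mul_one]
  filter_upwards [eventually_entry_betheVec hτ (hmero _ _ _) (fun _ => continuousAt_const) ht hne
      hv' (eventually_a_vFun hτ ha) Finset.univ,
    eventually_entry_betheVec hτ (hmero _ _ _) hspec ht hne hv' (eventually_d_vFun hτ (by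
      simpa only [thetaQuot, spectralProd, Dfun, sub_zero] using hd)) Finset.univ,
    tendsto_snd_residual_codiscrete.eventually h₀,
    tendsto_snd_residual_codiscrete.eventually h₁] with x ha hd h₀ h₁
  rw [← betheExpansion_add_betheExpansion h h₀ h₁, ← ha, ← hd]
  rfl

end EModule

lemma tendsto_div_of_hasDerivAt {f g : ℂ → ℂ} {f' g' x : ℂ} (hf : HasDerivAt f f' x)
    (hg : HasDerivAt g g' x) (hfx : f x = 0) (hgx : g x = 0) (hg' : g' ≠ 0) :
    Tendsto (fun y => f y / g y) (𝓝[≠] x) (𝓝 (f' / g')) := by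
  refine (hf.tendsto_slope.div hg.tendsto_slope hg').congr' ?_
  filter_upwards [self_mem_nhdsWithin] with y hy
  have : y - x ≠ 0 := sub_ne_zero.2 hy
  simp only [slope_def_field, hfx, hgx, sub_zero, Pi.div_apply]
  field_simp

/-- The Bethe equations make the numerator of `eigval` vanish at its apparent simple pole `t i`. -/
lemma exists_tendsto_eigval_self (hτ : 0 < τ.im) (hne : Pairwise fun i j => theta τ (t i - t j) ≠ 0)
    (h : BetheEqs τ η c p q t) (i : Fin m) :
    ∃ e, Tendsto (eigval τ η c p q t) (𝓝[≠] t i) (𝓝 e) := by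
  have hθ := differentiable_theta hτ
  have hnum (κ : ℂ) : DifferentiableAt ℂ (fun w => theta τ (t i - w - κ) *
      exchangeProd τ κ t (Finset.univ.erase i) w) (t i) :=
    DifferentiableAt.fun_mul
      (hθ.comp (g := theta τ) (by fun_prop : Differentiable ℂ fun w => t i - w - κ) _)
      (differentiableAt_exchangeProd hτ κ fun j hj => hne (Finset.ne_of_mem_erase hj))
  have hden : HasDerivAt (fun w => theta τ (t i - w)) (-deriv (theta τ) 0) (t i) := by
    have := (hθ (t i - t i)).hasDerivAt.comp_const_sub (t i) (t i)
    rwa [sub_self] at this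
  have hF := (((hnum (2 * η)).const_mul (exp (-2 * η * c))).fun_add
    (((hnum (-(2 * η))).const_mul (exp (2 * η * c))).fun_mul
      (differentiableAt_spectralProd (p := p) hτ (h.theta_sub_ne_zero i)))).hasDerivAt
  refine ⟨_, (tendsto_div_of_hasDerivAt hF hden ?_ (by rw [sub_self, theta_zero])
    (neg_ne_zero.2 (deriv_theta_zero_ne_zero hτ))).congr fun w => ?_⟩
  · rw [sub_self, zero_sub, zero_sub, neg_neg, theta_neg]
    linear_combination -theta τ (2 * η) * h.exchangeProd_eq i
  · have hsplit (κ : ℂ) : exchangeProd τ κ t Finset.univ w =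
        theta τ (t i - w - κ) / theta τ (t i - w) *
          exchangeProd τ κ t (Finset.univ.erase i) w := by
      rw [← exchangeProd_insert (Finset.notMem_erase i _), Finset.insert_erase (Finset.mem_univ i)]
    rw [eigval_eq_exchangeProd, hsplit, hsplit]
    ring

lemma theta_add_div_theta_add {x : ℂ × ℂ} (hx : x ∈ quasiPeriods τ) (a b : ℂ) :
    theta τ (a + x.1) / theta τ (b + x.1) = exp (x.2 * (a - b)) * (theta τ a / theta τ b) := by
  obtain ⟨C, hC, h⟩ := hx
  rw [h, h, mul_sub, exp_sub]
  have := exp_ne_zero (x.2 * b)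
  field_simp

lemma exchangeProd_sub {x : ℂ × ℂ} (hx : x ∈ quasiPeriods τ) {ι : Type*} (κ : ℂ) (t : ι → ℂ)
    (S : Finset ι) (w : ℂ) : exchangeProd τ κ t S (w - x.1) =
      exp (-(x.2 * κ * S.card)) * exchangeProd τ κ t S w := by
  have hj (j : ι) : theta τ (t j - (w - x.1) - κ) / theta τ (t j - (w - x.1)) =
      exp (-(x.2 * κ)) * (theta τ (t j - w - κ) / theta τ (t j - w)) := by
    rw [show t j - (w - x.1) - κ = t j - w - κ + x.1 by ring,
      show t j - (w - x.1) = t j - w + x.1 by ring, theta_add_div_theta_add hx]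
    ring_nf
  simp only [exchangeProd, hj, Finset.prod_mul_distrib, Finset.prod_const, ← exp_nat_mul]
  congr 2
  ring

lemma spectralProd_sub {x : ℂ × ℂ} (hx : x ∈ quasiPeriods τ) (w : ℂ) :
    spectralProd τ p q (w - x.1) = exp (-(x.2 * ∑ k, (q k - p k))) * spectralProd τ p q w := by
  have hk (k : Fin n) : theta τ (w - x.1 - p k) / theta τ (w - x.1 - q k) =
      exp (-(x.2 * (q k - p k))) * (theta τ (w - p k) / theta τ (w - q k)) := by
    have := theta_add_div_theta_add (neg_mem hx) (w - p k) (w - q k)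
    rw [show w - x.1 - p k = w - p k + (-x).1 by rw [Prod.fst_neg]; ring,
      show w - x.1 - q k = w - q k + (-x).1 by rw [Prod.fst_neg]; ring, this, Prod.snd_neg]
    ring_nf
  simp only [spectralProd, hk, Finset.prod_mul_distrib, ← exp_sum, Finset.sum_neg_distrib,
    ← Finset.mul_sum]

lemma eigval_sub {x : ℂ × ℂ} (hx : x ∈ quasiPeriods τ) (hpq : ∑ k, (q k - p k) = 4 * η * m)
    (w : ℂ) : eigval τ η c p q t (w - x.1) = exp (-(x.2 * (2 * η) * m)) * eigval τ η c p q t w := by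
  have hexp : exp (-(x.2 * -(2 * η) * m)) * exp (-(x.2 * (4 * η * m))) =
      exp (-(x.2 * (2 * η) * m)) := by
    rw [← exp_add]; ring_nf
  simp only [eigval_eq_exchangeProd, exchangeProd_sub hx, spectralProd_sub hx, hpq,
    Finset.card_univ, Fintype.card_fin, ← hexp]
  ring

lemma exists_tendsto_eigval_of_theta_eq_zero (hτ : 0 < τ.im)
    (hne : Pairwise fun i j => theta τ (t i - t j) ≠ 0) (h : BetheEqs τ η c p q t)
    (hpq : ∑ k, (q k - p k) = 4 * η * m) {i : Fin m} {w : ℂ} (hw : theta τ (t i - w) = 0) :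
    ∃ e, Tendsto (eigval τ η c p q t) (𝓝[≠] w) (𝓝 e) := by
  obtain ⟨r, s, hrs⟩ := mem_lattice_of_theta_eq_zero hτ hw
  obtain ⟨e, he⟩ := exists_tendsto_eigval_self hτ hne h i
  set x : ℂ × ℂ := -(r + s * τ, -(2 * π * I * s)) with hx
  have hxτ : x ∈ quasiPeriods τ := neg_mem (lattice_mem_quasiPeriods r s)
  have hti : t i = w - x.1 := by
    rw [hx, Prod.fst_neg]
    linear_combination hrs
  rw [hti] at he
  have hshift := ((continuous_sub_right x.1).continuousWithinAt (s := {w}ᶜ)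
    (x := w)).tendsto_nhdsWithin (t := {w - x.1}ᶜ) fun _ => (sub_left_injective (b := x.1)).ne
  refine ⟨_, ((he.comp hshift).const_mul (exp (x.2 * (2 * η) * m))).congr fun y => ?_⟩
  rw [Function.comp_apply, eigval_sub hxτ hpq, ← mul_assoc, ← exp_add]
  simp

lemma exists_tendsto_eigval_of_tendsto_spectralProd (hτ : 0 < τ.im) {w e : ℂ}
    (hw : ∀ j, theta τ (t j - w) ≠ 0) (he : Tendsto (spectralProd τ p q) (𝓝[≠] w) (𝓝 e)) :
    ∃ e', Tendsto (eigval τ η c p q t) (𝓝[≠] w) (𝓝 e') := by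
  have hx (κ : ℂ) : Tendsto (exchangeProd τ κ t Finset.univ) (𝓝[≠] w)
      (𝓝 (exchangeProd τ κ t Finset.univ w)) :=
    (differentiableAt_exchangeProd hτ κ fun j _ => hw j).continuousAt.mono_left nhdsWithin_le_nhds
  exact ⟨_, (((hx (2 * η)).const_mul _).add (((hx (-(2 * η))).const_mul _).mul he)).congr
    fun y => (eigval_eq_exchangeProd y).symm⟩

lemma continuousAt_eigval (hτ : 0 < τ.im) {w : ℂ} (hw : ∀ j, theta τ (t j - w) ≠ 0)
    (hq : ∀ k, theta τ (w - q k) ≠ 0) : ContinuousAt (eigval τ η c p q t) w := by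
  have hx (κ : ℂ) : ContinuousAt (exchangeProd τ κ t Finset.univ) w :=
    (differentiableAt_exchangeProd hτ κ fun j _ => hw j).continuousAt
  refine (((hx (2 * η)).const_mul (exp (-2 * η * c))).fun_add
    (((hx (-(2 * η))).const_mul (exp (2 * η * c))).fun_mul
      (differentiableAt_spectralProd (p := p) hτ hq).continuousAt)).congr ?_
  exact Eventually.of_forall fun y => (eigval_eq_exchangeProd y).symm

/-- The equation need only hold generically, so `f` may have a singularity at `w`. -/
lemma tendsto_of_eventually_mul_eq {f : ℂ → ℂ} {G H : ℂ × ℂ → ℂ} {w l : ℂ}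
    (hf : ∀ᶠ y in 𝓝[≠] w, ContinuousAt f y) (hG : ContinuousAt G (w, l))
    (hH : ContinuousAt H (w, l)) (hG0 : G (w, l) ≠ 0)
    (h : ∀ᶠ x in residual (ℂ × ℂ), f x.1 * G x = H x) :
    Tendsto f (𝓝[≠] w) (𝓝 (H (w, l) / G (w, l))) := by
  refine (closed_nhds_basis _).tendsto_right_iff.2 fun V ⟨hV, hVc⟩ => ?_
  have hnear : ∀ᶠ y in 𝓝 w, ∀ᶠ x in 𝓝 (y, l), G x ≠ 0 ∧ H x / G x ∈ V :=
    (Continuous.prodMk_left l).continuousAt.eventually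
      ((hG.eventually_ne hG0).and ((hH.div hG hG0) hV)).eventually_nhds
  filter_upwards [hf, hnear.filter_mono nhdsWithin_le_nhds] with y hy hyl
  have hfreq : ∃ᶠ x in 𝓝 (y, l), f x.1 ∈ V := by
    have hdense := mem_closure_iff_frequently.1 (dense_of_mem_residual h (y, l))
    refine (hdense.and_eventually hyl).mono ?_
    rintro x ⟨hx, hx0, hxV⟩
    rwa [← hx, mul_div_cancel_right₀ _ hx0] at hxV
  exact hVc.mem_of_frequently_of_tendsto hfreq
    (ContinuousAt.comp (x := (y, l)) (f := Prod.fst) hy continuousAt_fst)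

namespace EModule

variable {W : Type*} [AddCommGroup W] [Module ℂ W] {M : EModule τ η W} {v₀ : ℂ → W}

lemma exists_tendsto_spectralProd (hτ : 0 < τ.im) {Λ μ : ℂ} (hv : M.MemFunWeight μ v₀)
    (hv0 : ¬ v₀ =ᶠ[codiscrete ℂ] 0)
    (hd : ∀ᶠ x in residual (ℂ × ℂ), M.d x.1 v₀ x.2 = Dfun τ η Λ p q x.1 x.2 • v₀ x.2)
    {w : ℂ} (hw : M.IsRegular w) : ∃ e, Tendsto (spectralProd τ p q) (𝓝[≠] w) (𝓝 e) := by
  have hθ := continuous_theta hτ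
  obtain ⟨l, hl, h1, h2, h3, h4⟩ := ((not_eventually.1 hv0).and_eventually
    ((hw.eventually_vcontAt_entry hv 1 1).and ((hv.1.eventually_vcontAt_snd w).and
      ((eventually_theta_ne_zero hτ).and (eventually_theta_sub_ne_zero hτ (2 * η * Λ)))))).exists
  obtain ⟨φ, hφ⟩ : ∃ φ : Module.Dual ℂ W, φ (v₀ l) ≠ 0 := by
    by_contra! h
    exact hl ((Module.forall_dual_apply_eq_zero_iff ℂ _).1 h)
  have hG : ContinuousAt (fun y : ℂ × ℂ => theta τ (y.2 - 2 * η * Λ) / theta τ y.2 * φ (v₀ y.2))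
      (w, l) :=
    (ContinuousAt.div (f := fun y : ℂ × ℂ => theta τ (y.2 - 2 * η * Λ))
      (g := fun y : ℂ × ℂ => theta τ y.2) (by fun_prop) (by fun_prop) h3).mul
      (h2.continuousAt_dual φ)
  have hcont : ∀ᶠ y in codiscrete ℂ, ContinuousAt (spectralProd τ p q) y := by
    filter_upwards [eventually_all.2 fun k => eventually_theta_sub_ne_zero hτ (q k)] with y hy
    exact (differentiableAt_spectralProd hτ hy).continuousAt
  refine ⟨_, tendsto_of_eventually_mul_eq (nhdsNE_le_codiscrete w hcont) hG (h1.continuousAt_dual φ)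
    (mul_ne_zero (div_ne_zero h4 h3) hφ) ?_⟩
  filter_upwards [hd] with x hx
  rw [show M.entry 1 1 x.1 v₀ x.2 = M.d x.1 v₀ x.2 from rfl, hx, map_smul, smul_eq_mul, Dfun,
    spectralProd]
  ring

lemma exists_tendsto_eigval (hτ : 0 < τ.im) (hne : Pairwise fun i j => theta τ (t i - t j) ≠ 0)
    (h : BetheEqs τ η c p q t) (hpq : ∑ k, (q k - p k) = 4 * η * m) {Λ μ : ℂ}
    (hv : M.MemFunWeight μ v₀) (hv0 : ¬ v₀ =ᶠ[codiscrete ℂ] 0)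
    (hd : ∀ᶠ x in residual (ℂ × ℂ), M.d x.1 v₀ x.2 = Dfun τ η Λ p q x.1 x.2 • v₀ x.2)
    {w : ℂ} (hw : M.IsRegular w) : ∃ e, Tendsto (eigval τ η c p q t) (𝓝[≠] w) (𝓝 e) := by
  by_cases htw : ∀ j, theta τ (t j - w) ≠ 0
  · obtain ⟨e, he⟩ := exists_tendsto_spectralProd hτ hv hv0 hd hw
    exact exists_tendsto_eigval_of_tendsto_spectralProd hτ htw he
  · push Not at htw
    obtain ⟨i, hi⟩ := htw
    exact exists_tendsto_eigval_of_theta_eq_zero hτ hne h hpq hi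

lemma T_eq_of_tendsto {μ : ℂ} {ψ : ℂ → W} (hψ : M.MemFunWeight μ ψ) {f : ℂ → ℂ}
    (h : ∀ᶠ x in residual (ℂ × ℂ), M.T x.1 ψ x.2 = f x.1 • ψ x.2) {w e : ℂ} (hw : M.IsRegular w)
    (he : Tendsto f (𝓝[≠] w) (𝓝 e)) : M.T w ψ =ᶠ[codiscrete ℂ] e • ψ := by
  have hne : ∀ᶠ y in codiscrete ℂ, y ≠ w := compl_singleton_mem_codiscreteWithin w
  filter_upwards [hw.eventually_vcontAt_entry hψ 0 0, hw.eventually_vcontAt_entry hψ 1 1,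
    hψ.1.eventually_vcontAt_snd w] with l h0 h1 h2
  have hf : ContinuousAt (fun y : ℂ × ℂ => Function.update f w e y.1) (w, l) :=
    ContinuousAt.comp (x := (w, l)) (f := Prod.fst) (continuousAt_update_same.2 he) continuousAt_fst
  have := (h0.add h1).eq_of_residual (h2.smul hf) ?_
  · rwa [Function.update_self] at this
  · filter_upwards [h, tendsto_fst_residual_codiscrete.eventually hne] with x hx hxw
    rwa [Function.update_of_ne hxw]

lemma betheVec_univ {v : ℂ → W} : M.betheVec t v Finset.univ = M.bProd (List.ofFn t) v := by
  rw [betheVec, Fin.sort_univ, List.ofFn_eq_map]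

end EModule

lemma sum_qPt_sub_pPt (η : ℂ) (z Λs : Fin n → ℂ) :
    ∑ k, (qPt η z Λs k - pPt η z Λs k) = 2 * η * ∑ k, Λs k := by
  rw [Finset.mul_sum]
  refine Finset.sum_congr rfl fun k _ => ?_
  rw [pPt, qPt]
  ring

end Eigenvalue

end EllipticBethe

end

open EllipticBethe in
theorem mainTheorem1_general (τ η c : ℂ) (hτ : 0 < τ.im) {W : Type*} [AddCommGroup W] [Module ℂ W]
    (M : EModule τ η W) (n m : ℕ) (p q : Fin n → ℂ) (hpq : ∑ k, (q k - p k) = 4 * η * m)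
    (v₀ : ℂ → W) (hv : M.MemFunWeight (2 * m) v₀) (hv0 : ¬ v₀ =ᶠ[codiscrete ℂ] 0)
    (ha : Dense (interior {x : ℂ × ℂ | M.a x.1 v₀ x.2 = v₀ x.2}))
    (hd : Dense (interior {x : ℂ × ℂ | M.d x.1 v₀ x.2 = Dfun τ η (2 * m) p q x.1 x.2 • v₀ x.2}))
    (t : Fin m → ℂ) (ht_reg : ∀ i, M.IsRegular (t i))
    (ht_distinct : ∀ i j, i < j → ∀ r s : ℤ, t i - t j ≠ r + s * τ)
    (ht_bethe : BetheEqs τ η c p q t)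
    (ψ : ℂ → W) (hψ : ψ = M.bProd (List.ofFn t) (vFun τ η c m v₀)) :
    M.MemFunWeight 0 ψ ∧ ∀ w, M.IsRegular w →
      ((∀ j, theta τ (t j - w) ≠ 0) → (∀ k, theta τ (w - q k) ≠ 0) →
        M.T w ψ =ᶠ[codiscrete ℂ] eigval τ η c p q t w • ψ) ∧
      ∃ e, Tendsto (eigval τ η c p q t) (𝓝[≠] w) (𝓝 e) ∧ M.T w ψ =ᶠ[codiscrete ℂ] e • ψ := by
  have hne := theta_sub_ne_zero_of_distinct hτ ht_distinct
  replace ha := eventually_residual_of_dense_interior ha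
  replace hd := eventually_residual_of_dense_interior hd
  rw [← EModule.betheVec_univ] at hψ
  have hmem : M.MemFunWeight 0 ψ := by
    have := EModule.memFunWeight_betheVec ht_reg
      (EModule.memFunWeight_vFun (c := c) (m := m) hτ hv) Finset.univ
    rwa [Finset.card_univ, Fintype.card_fin, sub_self, ← hψ] at this
  have hT := EModule.eventually_T_betheVec hτ ht_reg hne ht_bethe hv ha hd
  rw [← hψ] at hT
  refine ⟨hmem, fun w hw => ⟨fun htw hqw => EModule.T_eq_of_tendsto hmem hT hw
    ((continuousAt_eigval hτ htw hqw).mono_left nhdsWithin_le_nhds), ?_⟩⟩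
  obtain ⟨e, he⟩ := EModule.exists_tendsto_eigval hτ hne ht_bethe hpq hv hv0 hd hw
  exact ⟨e, he, EModule.T_eq_of_tendsto hmem hT hw he⟩

theorem mainTheorem1 (τ η c : ℂ) (hτ : 0 < τ.im) {W : Type*} [AddCommGroup W] [Module ℂ W]
    (M : EllipticBethe.EModule τ η W) (n m : ℕ) (z Λs : Fin n → ℂ) (p q : Fin n → ℂ)
    (hp : p = EllipticBethe.pPt η z Λs) (hq : q = EllipticBethe.qPt η z Λs)
    (Λ : ℂ) (hΛs : Λ = ∑ j, Λs j) (hΛ : Λ = 2 * (m : ℂ)) (v₀ : ℂ → W)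
    (hW : M.IsHighestWeight Λ (fun _ _ => 1) (EllipticBethe.Dfun τ η Λ p q) v₀)
    (t : Fin m → ℂ) (ht_reg : ∀ i, M.IsRegular (t i))
    (ht_distinct : ∀ i j, i < j → ∀ r s : ℤ, t i - t j ≠ r + s * τ)
    (ht_bethe : EllipticBethe.BetheEqs τ η c p q t)
    (ψ : ℂ → W) (hψ : ψ = M.bProd (List.ofFn t) (EllipticBethe.vFun τ η c m v₀)) :
    M.MemFunWeight 0 ψ ∧
    ∀ w : ℂ, M.IsRegular w →
      ((∀ j, EllipticBethe.theta τ (t j - w) ≠ 0) → (∀ k, EllipticBethe.theta τ (w - q k) ≠ 0) →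
        M.T w ψ =ᶠ[Filter.codiscrete ℂ] EllipticBethe.eigval τ η c p q t w • ψ) ∧
      ∃ e : ℂ, Filter.Tendsto (EllipticBethe.eigval τ η c p q t) (nhdsWithin w {w}ᶜ) (nhds e) ∧
        M.T w ψ =ᶠ[Filter.codiscrete ℂ] e • ψ := by
  have hpq : ∑ k, (q k - p k) = 4 * η * m := by
    rw [hp, hq, EllipticBethe.sum_qPt_sub_pPt, ← hΛs, hΛ]
    ring
  subst hΛ
  exact mainTheorem1_general τ η c hτ M n m p q hpq v₀ hW.mem hW.ne_zero
    (by simpa only [one_smul] using hW.a_eq) hW.d_eq t ht_reg ht_distinct ht_bethe ψ hψ
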